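/- Let $G$ be a group acting by uniform maps (and morphisms of bornological coarse spaces) on a uniform bornological coarse space $X$. Assume that $X$ is bornologically bounded and has the maximal coarse structure, that every uniform entourage $V$ of $X$ admits a finite $V$-dense subset, and that $X$ admits a uniform scale (a sequence of uniform entourages which is cofinal in the uniform structure). Let $\nu$ be a $G$-invariant Borel probability measure on $X$ with $\mathrm{supp}(\nu)=X$ such that $G$ acts ergodically on $(X,\nu)$ and the unitary action $\rho$ of $G$ on $H=L^2(X,\nu)$ has a spectral gap, i.e. there are a finite subset $S\subseteq G$ and $\kappa\in(0,1)$ with $\sup_{s\in S}\|h-\rho(s)h\|\ge\kappa\|h\|$ for all $h\in (H^G)^\perp$. Let $\mathrm{Sq}(X)$ be the squeezing space: the set $\mathbb Z\times X$ with the bornology generated by the sets $F\times B$ ($F$ finite, $B$ bounded) and the coarse structure of all sub-entourages of $(\mathrm{diag}(\mathbb Z)\times U)\cap W$, where $U$ is a coarse entourage of $X$ and $W$ is such that for every uniform entourage $V$ of $X$ the restrictions $W_n$ of $W$ to $\{n\}\times X$ satisfy $W_n\subseteq V$ for all sufficiently large $n$. Let $\mathrm{Sq}(X)//G$ be the same bornological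 space with the coarse structure generated by that of $\mathrm{Sq}(X)$ and the sets $\{(gy,y)\mid y\in \mathbb Z\times X\}$, $g\in G$. Let $\hat\nu$ be the product of the counting measure with $\nu$, $\hat H=L^2(\mathbb Z\times X,\hat\nu)$, and let $\hat P$ be the Drutu–Nowak projection, the orthogonal projection of $\hat H$ onto the functions which are constant on $\{n\}\times X$ for every $n$. Then there exist a coarse entourage $V$ of $\mathrm{Sq}(X)$ all of whose components $V_n$ are uniform entourages of $X$, a measurable $V^2$-bounded partition $(B_i)_{i\in I}$ of a subset of full measure of $\mathbb Z\times X$ with $\hat\nu(B_i)>0$ (bounded in the sense that each $B_i$ is contained in some $V^2[y]$), and a locally finite $V^5$-dense family $(b_i)_{i\in I}$ with $b_i\in B_i$. For every such choice, with $\hat\mu=\sum_{i}\hat\nu(B_i)\delta_{b_i}$ the resulting projection-valued measure on $\hat H$ (where $\hat\nu(B_i)$ acts as multiplication by the characteristic function of $B_i$): 1. $\hat P\in C(\mathrm{Sq}(X)//G,\hat H,\hat\mu)$, the Roe algebra, i.e. the $C^*$-subalgebra of $B(\hat H)$ generated by the locally finite and controlled operators. 2. Consequently $\hat P$ defines a class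 $p\in\pi_0K\mathcal X(\mathrm{Sq}(X)//G)$. Here $\pi_0K\mathcal X(Y)$ is $K_0$ of the $C^*$-category of locally finite $Y$-controlled Hilbert spaces determined on points and bounded operators which can be approximated by controlled ones, and $p$ is the unique class represented by a projection in this category which is Murray–von Neumann equivalent to $\hat P$ via a partial isometry which can be approximated by controlled operators. The class $p$ is invariant under the $\mathbb Z$-action induced by the shifts $(n,x)\mapsto(n+k,x)$, and for every $n\in\mathbb Z$ its component at $\{n\}\times X$ has trace $1$. -/

import Mathlib

open MeasureTheory Filter Topology Set
open scoped SetRel Uniformity InnerProductSpace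

universe u v w

noncomputable section

/-! ## Bornological coarse spaces -/

/-- A bornological coarse structure on the set `Y`: a bornology and a coarse structure which are
compatible, i.e. coarse thickenings of bounded sets are bounded.  For an entourage `U` and a subset
`S` the thickening is `U[S] = {x | ∃ s ∈ S, (x, s) ∈ U} = U.preimage S`. -/
structure BornCoarse (Y : Type u) where
  /-- the bornology (finite sets are bounded) -/
  born : Bornology Y
  /-- the coarse entourages -/
  IsEntourage : SetRel Y Y → Prop
  diag : IsEntourage SetRel.id
  mono : ∀ {U V : SetRel Y Y}, IsEntourage V → U ⊆ V → IsEntourage U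
  union : ∀ {U V : SetRel Y Y}, IsEntourage U → IsEntourage V → IsEntourage (U ∪ V)
  inv : ∀ {U : SetRel Y Y}, IsEntourage U → IsEntourage U.inv
  comp : ∀ {U V : SetRel Y Y}, IsEntourage U → IsEntourage V → IsEntourage (U ○ V)
  compat : ∀ {U : SetRel Y Y} {S : Set Y}, IsEntourage U → @Bornology.IsBounded Y born S →
    @Bornology.IsBounded Y born (U.preimage S)

namespace BornCoarse

variable {Y : Type u} {Y' : Type v}

/-- The bounded subsets. -/
abbrev IsBdd (𝒴 : BornCoarse Y) (S : Set Y) : Prop := @Bornology.IsBounded Y 𝒴.born S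

/-- Morphisms of bornological coarse spaces: proper and controlled maps. -/
structure IsMorphism (𝒴 : BornCoarse Y) (𝒴' : BornCoarse Y') (f : Y → Y') : Prop where
  proper : ∀ S : Set Y', 𝒴'.IsBdd S → 𝒴.IsBdd (f ⁻¹' S)
  controlled : ∀ U : SetRel Y Y, 𝒴.IsEntourage U → 𝒴'.IsEntourage (Prod.map f f '' U)

/-- The coarse structure generated by a family of relations. -/
inductive Generate (𝓔 : SetRel Y Y → Prop) : SetRel Y Y → Prop
  | basic {U : SetRel Y Y} : 𝓔 U → Generate 𝓔 U
  | diag : Generate 𝓔 SetRel.id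
  | mono {U V : SetRel Y Y} : Generate 𝓔 V → U ⊆ V → Generate 𝓔 U
  | union {U V : SetRel Y Y} : Generate 𝓔 U → Generate 𝓔 V → Generate 𝓔 (U ∪ V)
  | inv {U : SetRel Y Y} : Generate 𝓔 U → Generate 𝓔 U.inv
  | comp {U V : SetRel Y Y} : Generate 𝓔 U → Generate 𝓔 V → Generate 𝓔 (U ○ V)

theorem Generate.bounded {𝓔 : SetRel Y Y → Prop} (b : Bornology Y)
    (h : ∀ U, 𝓔 U → ∀ S, Bornology.IsBounded S →
      Bornology.IsBounded (U.preimage S) ∧ Bornology.IsBounded (U.image S))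
    {U : SetRel Y Y} (hU : Generate 𝓔 U) : ∀ S : Set Y, Bornology.IsBounded S →
      Bornology.IsBounded (U.preimage S) ∧ Bornology.IsBounded (U.image S) := by
  induction hU with
  | basic hU => exact h _ hU
  | diag =>
    intro S hS
    refine ⟨hS.subset ?_, hS.subset ?_⟩
    · rintro x ⟨y, hy, rfl⟩; exact hy
    · rintro x ⟨y, hy, rfl⟩; exact hy
  | mono _ hUV ih =>
    intro S hS
    refine ⟨(ih S hS).1.subset ?_, (ih S hS).2.subset ?_⟩
    · rintro x ⟨y, hy, hxy⟩; exact ⟨y, hy, hUV hxy⟩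
    · rintro x ⟨y, hy, hxy⟩; exact ⟨y, hy, hUV hxy⟩
  | union _ _ ih₁ ih₂ =>
    intro S hS
    refine ⟨((ih₁ S hS).1.union (ih₂ S hS).1).subset ?_,
      ((ih₁ S hS).2.union (ih₂ S hS).2).subset ?_⟩
    · rintro x ⟨y, hy, hxy | hxy⟩
      · exact Or.inl ⟨y, hy, hxy⟩
      · exact Or.inr ⟨y, hy, hxy⟩
    · rintro x ⟨y, hy, hxy | hxy⟩
      · exact Or.inl ⟨y, hy, hxy⟩
      · exact Or.inr ⟨y, hy, hxy⟩
  | inv _ ih =>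
    intro S hS
    exact ⟨(ih S hS).2, (ih S hS).1⟩
  | comp _ _ ih₁ ih₂ =>
    intro S hS
    refine ⟨(ih₁ _ (ih₂ S hS).1).1.subset ?_, (ih₂ _ (ih₁ S hS).2).2.subset ?_⟩
    · rintro x ⟨z, hz, y, hxy, hyz⟩; exact ⟨y, ⟨z, hz, hyz⟩, hxy⟩
    · rintro x ⟨z, hz, y, hxy, hyz⟩; exact ⟨y, ⟨z, hz, hxy⟩, hyz⟩

theorem compat' (𝒴 : BornCoarse Y) {U : SetRel Y Y} (hU : 𝒴.IsEntourage U) {S : Set Y}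
    (hS : 𝒴.IsBdd S) : 𝒴.IsBdd (U.image S) :=
  𝒴.compat (𝒴.inv hU) hS

/-- The quotient `Y//G` for an action of `G` on `Y` by morphisms: the same bornology, and the coarse
structure generated by the one of `Y` and by the entourages `U_g = {(g y, y) | y ∈ Y}`. -/
def quot {G : Type w} [Group G] (𝒴 : BornCoarse Y) (act : G →* Equiv.Perm Y)
    (h : ∀ g, 𝒴.IsMorphism 𝒴 (act g)) : BornCoarse Y where
  born := 𝒴.born
  IsEntourage := Generate fun U => 𝒴.IsEntourage U ∨ ∃ g : G, U = {p | p.1 = act g p.2}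
  diag := .diag
  mono := .mono
  union := .union
  inv := .inv
  comp := .comp
  compat := by
    intro U S hU hS
    refine (Generate.bounded 𝒴.born ?_ hU S hS).1
    rintro U (hU | ⟨g, rfl⟩) S hS
    · exact ⟨𝒴.compat hU hS, 𝒴.compat' hU hS⟩
    · constructor
      · refine Bornology.IsBounded.subset ((h g⁻¹).proper S hS) ?_
        rintro x ⟨y, hy, hxy⟩
        have hxy : x = act g y := hxy
        simpa [hxy] using hy
      · refine Bornology.IsBounded.subset ((h g).proper S hS) ?_
        rintro x ⟨y, hy, hxy⟩
        have hxy : y = act g x := hxy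
        simpa [hxy] using hy

end BornCoarse

/-! ## The squeezing space -/

section Squeezing

variable {X : Type u}

/-- The restriction `W_n` of a relation `W` on `ℤ × X` to the `n`-th component, as a relation on
`X`. -/
def compAt (W : SetRel (ℤ × X) (ℤ × X)) (n : ℤ) : SetRel X X := {p | ((n, p.1), (n, p.2)) ∈ W}

/-- The bornology of the squeezing space, generated by `F × B` with `F ⊆ ℤ` finite and `B ⊆ X`
bounded. -/
abbrev sqBornology (𝒳 : BornCoarse X) : Bornology (ℤ × X) :=
  Bornology.ofBounded {S | ∃ (F : Set ℤ) (B : Set X), F.Finite ∧ 𝒳.IsBdd B ∧ S ⊆ F ×ˢ B}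
    ⟨∅, ∅, finite_empty, @Bornology.isBounded_empty X 𝒳.born, empty_subset _⟩
    (by
      rintro S ⟨F, B, hF, hB, hS⟩ T hT
      exact ⟨F, B, hF, hB, hT.trans hS⟩)
    (by
      rintro S ⟨F, B, hF, hB, hS⟩ T ⟨F', B', hF', hB', hT⟩
      refine ⟨F ∪ F', B ∪ B', hF.union hF', Bornology.IsBounded.union hB hB', ?_⟩
      rintro ⟨n, x⟩ (h | h)
      · exact ⟨Or.inl (hS h).1, Or.inl (hS h).2⟩
      · exact ⟨Or.inr (hT h).1, Or.inr (hT h).2⟩)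
    (by
      rintro ⟨n, x⟩
      refine ⟨{n}, {x}, finite_singleton n, @Bornology.isBounded_singleton X 𝒳.born x, ?_⟩
      simp)

theorem sqBornology_isBounded (𝒳 : BornCoarse X) (S : Set (ℤ × X)) :
    @Bornology.IsBounded _ (sqBornology 𝒳) S ↔
      ∃ (F : Set ℤ) (B : Set X), F.Finite ∧ 𝒳.IsBdd B ∧ S ⊆ F ×ˢ B :=
  Bornology.isBounded_ofBounded_iff _

variable [UniformSpace X]

/-- The coarse entourages of the squeezing space: sub-relations of `(diag ℤ × U) ∩ W`, where `U` is a
coarse entourage of `X` and the components `W_n` become smaller than every given uniform entourage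
for `n → ∞`. -/
def IsSqEntourage (𝒳 : BornCoarse X) (E : SetRel (ℤ × X) (ℤ × X)) : Prop :=
  ∃ (U : SetRel X X) (W : SetRel (ℤ × X) (ℤ × X)), 𝒳.IsEntourage U ∧
    (∀ V ∈ 𝓤 X, ∃ n₀ : ℤ, ∀ n, n₀ ≤ n → compAt W n ⊆ V) ∧
    E ⊆ {p | p.1.1 = p.2.1 ∧ (p.1.2, p.2.2) ∈ U} ∩ W

theorem isSqEntourage_iff (𝒳 : BornCoarse X) (E : SetRel (ℤ × X) (ℤ × X)) :
    IsSqEntourage 𝒳 E ↔ (∃ U, 𝒳.IsEntourage U ∧ ∀ p ∈ E, p.1.1 = p.2.1 ∧ (p.1.2, p.2.2) ∈ U) ∧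
      ∀ V ∈ 𝓤 X, ∃ n₀ : ℤ, ∀ n, n₀ ≤ n → compAt E n ⊆ V := by
  constructor
  · rintro ⟨U, W, hU, hW, hE⟩
    refine ⟨⟨U, hU, fun p hp => (hE hp).1⟩, fun V hV => ?_⟩
    obtain ⟨n₀, h⟩ := hW V hV
    exact ⟨n₀, fun n hn p hp => h n hn (hE hp).2⟩
  · rintro ⟨⟨U, hU, hE⟩, hW⟩
    exact ⟨U, E, hU, hW, fun p hp => ⟨hE p hp, hp⟩⟩

/-- The squeezing space `Sq(X)`, with underlying set `ℤ × X`. -/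
def Sq (𝒳 : BornCoarse X) : BornCoarse (ℤ × X) where
  born := sqBornology 𝒳
  IsEntourage := IsSqEntourage 𝒳
  diag := by
    rw [isSqEntourage_iff]
    refine ⟨⟨SetRel.id, 𝒳.diag, ?_⟩, fun V hV => ⟨0, fun n _ => ?_⟩⟩
    · rintro ⟨⟨n, x⟩, ⟨m, y⟩⟩ h
      obtain ⟨rfl, rfl⟩ := Prod.mk.inj (show (n, x) = (m, y) from h)
      exact ⟨rfl, rfl⟩
    · rintro ⟨x, y⟩ h
      obtain ⟨-, rfl⟩ := Prod.mk.inj (show (n, x) = (n, y) from h)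
      exact refl_mem_uniformity hV
  mono := by
    rintro E E' ⟨U, W, hU, hW, hE⟩ h
    exact ⟨U, W, hU, hW, h.trans hE⟩
  union := by
    intro E E' h h'
    rw [isSqEntourage_iff] at *
    obtain ⟨⟨U, hU, hE⟩, hW⟩ := h
    obtain ⟨⟨U', hU', hE'⟩, hW'⟩ := h'
    refine ⟨⟨U ∪ U', 𝒳.union hU hU', ?_⟩, fun V hV => ?_⟩
    · rintro p (hp | hp)
      · exact ⟨(hE p hp).1, Or.inl (hE p hp).2⟩
      · exact ⟨(hE' p hp).1, Or.inr (hE' p hp).2⟩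
    · obtain ⟨n, hn⟩ := hW V hV
      obtain ⟨n', hn'⟩ := hW' V hV
      refine ⟨max n n', fun k hk => ?_⟩
      rintro p (hp | hp)
      · exact hn k (le_trans (le_max_left _ _) hk) hp
      · exact hn' k (le_trans (le_max_right _ _) hk) hp
  inv := by
    intro E h
    rw [isSqEntourage_iff] at *
    obtain ⟨⟨U, hU, hE⟩, hW⟩ := h
    refine ⟨⟨U.inv, 𝒳.inv hU, fun p hp => ⟨(hE p.swap hp).1.symm, (hE p.swap hp).2⟩⟩,
      fun V hV => ?_⟩
    obtain ⟨n, hn⟩ := hW _ (symm_le_uniformity hV)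
    exact ⟨n, fun k hk p hp => hn k hk (a := p.swap) hp⟩
  comp := by
    intro E E' h h'
    rw [isSqEntourage_iff] at *
    obtain ⟨⟨U, hU, hE⟩, hW⟩ := h
    obtain ⟨⟨U', hU', hE'⟩, hW'⟩ := h'
    refine ⟨⟨U ○ U', 𝒳.comp hU hU', ?_⟩, fun V hV => ?_⟩
    · rintro p ⟨q, hq, hq'⟩
      exact ⟨(hE _ hq).1.trans (hE' _ hq').1, q.2, (hE _ hq).2, (hE' _ hq').2⟩
    · obtain ⟨V', hV', hVV⟩ := comp_mem_uniformity_sets hV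
      obtain ⟨n, hn⟩ := hW V' hV'
      obtain ⟨n', hn'⟩ := hW' V' hV'
      refine ⟨max n n', fun k hk => ?_⟩
      rintro ⟨x, z⟩ ⟨⟨m, y⟩, hq, hq'⟩
      have hkm : k = m := (hE _ hq).1
      subst hkm
      exact hVV ⟨y, hn k (le_trans (le_max_left _ _) hk) hq,
        hn' k (le_trans (le_max_right _ _) hk) hq'⟩
  compat := by
    intro E S hE hS
    rw [isSqEntourage_iff] at hE
    rw [sqBornology_isBounded] at *
    obtain ⟨⟨U, hU, hE⟩, -⟩ := hE
    obtain ⟨F, B, hF, hB, hS⟩ := hS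
    refine ⟨F, U.preimage B, hF, 𝒳.compat hU hB, ?_⟩
    rintro p ⟨q, hq, hpq⟩
    have h1 : p.1 = q.1 := (hE _ hpq).1
    exact ⟨show p.1 ∈ F from h1 ▸ (hS hq).1, q.2, (hS hq).2, (hE _ hpq).2⟩

/-- The action of `G` on `ℤ × X` by `g (n, x) = (n, g x)`. -/
def sqAct (G : Type v) (X : Type u) [Group G] [MulAction G X] : G →* Equiv.Perm (ℤ × X) where
  toFun g := (Equiv.refl ℤ).prodCongr (MulAction.toPerm g)
  map_one' := by ext p <;> simp
  map_mul' g h := by ext p <;> simp [mul_smul]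

variable {G : Type v} [Group G] [MulAction G X]

theorem sqAct_isMorphism [UniformContinuousConstSMul G X] (𝒳 : BornCoarse X)
    (h : ∀ g : G, 𝒳.IsMorphism 𝒳 (fun x => g • x)) (g : G) :
    (Sq 𝒳).IsMorphism (Sq 𝒳) (sqAct G X g) where
  proper S hS := by
    obtain ⟨F, B, hF, hB, hS⟩ := (sqBornology_isBounded 𝒳 S).1 hS
    exact (sqBornology_isBounded 𝒳 _).2
      ⟨F, (fun x => g • x) ⁻¹' B, hF, (h g).proper B hB, fun p hp => ⟨(hS hp).1, (hS hp).2⟩⟩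
  controlled E hE := by
    obtain ⟨⟨U, hU, hE⟩, hW⟩ := (isSqEntourage_iff 𝒳 E).1 hE
    refine (isSqEntourage_iff 𝒳 _).2 ⟨⟨_, (h g).controlled U hU, ?_⟩, fun V hV => ?_⟩
    · rintro _ ⟨p, hp, rfl⟩
      exact ⟨(hE p hp).1, (p.1.2, p.2.2), (hE p hp).2, rfl⟩
    · obtain ⟨n, hn⟩ := hW _ (uniformContinuous_const_smul g hV)
      refine ⟨n, fun k hk => ?_⟩
      rintro ⟨x, y⟩ ⟨⟨⟨a, x'⟩, ⟨b, y'⟩⟩, hp, hpe⟩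
      obtain ⟨h1, h2⟩ := Prod.mk.inj hpe
      obtain ⟨e1, e2⟩ := Prod.mk.inj (show (a, g • x') = (k, x) from h1)
      obtain ⟨e3, e4⟩ := Prod.mk.inj (show (b, g • y') = (k, y) from h2)
      subst e1 e2 e3 e4
      exact hn _ hk (a := (x', y')) hp

/-- The quotient `Sq(X)//G` of the squeezing space, for an action of `G` on `X` by uniform maps which
are morphisms of bornological coarse spaces. -/
def SqQuot [UniformContinuousConstSMul G X] (𝒳 : BornCoarse X)
    (h : ∀ g : G, 𝒳.IsMorphism 𝒳 (fun x => g • x)) : BornCoarse (ℤ × X) :=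
  (Sq 𝒳).quot (sqAct G X) (sqAct_isMorphism 𝒳 h)

variable (X) in
/-- The shift `(n, x) ↦ (n + k, x)`, giving the `ℤ`-action on the squeezing space. -/
def shift (k : ℤ) (p : ℤ × X) : ℤ × X := (p.1 + k, p.2)

theorem shift_isMorphism_sq (𝒳 : BornCoarse X) (k : ℤ) :
    (Sq 𝒳).IsMorphism (Sq 𝒳) (shift X k) where
  proper S hS := by
    obtain ⟨F, B, hF, hB, hS⟩ := (sqBornology_isBounded 𝒳 S).1 hS
    refine (sqBornology_isBounded 𝒳 _).2 ⟨(fun n => n - k) '' F, B, hF.image _, hB, ?_⟩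
    exact fun p hp => ⟨⟨p.1 + k, (hS hp).1, by simp⟩, (hS hp).2⟩
  controlled E hE := by
    obtain ⟨⟨U, hU, hE⟩, hW⟩ := (isSqEntourage_iff 𝒳 E).1 hE
    refine (isSqEntourage_iff 𝒳 _).2 ⟨⟨U, hU, ?_⟩, fun V hV => ?_⟩
    · rintro _ ⟨p, hp, rfl⟩
      exact ⟨congrArg (· + k) (hE p hp).1, (hE p hp).2⟩
    · obtain ⟨n, hn⟩ := hW V hV
      refine ⟨n + k, fun m hm => ?_⟩
      rintro ⟨x, y⟩ ⟨⟨⟨a, x'⟩, ⟨b, y'⟩⟩, hp, hpe⟩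
      obtain ⟨h1, h2⟩ := Prod.mk.inj hpe
      obtain ⟨h1, h1'⟩ := Prod.mk.inj (show (a + k, x') = (m, x) from h1)
      obtain ⟨h2, h2'⟩ := Prod.mk.inj (show (b + k, y') = (m, y) from h2)
      obtain rfl : a = b := by omega
      subst h1' h2'
      exact hn a (by omega) (a := (x', y')) hp

theorem shift_isMorphism [UniformContinuousConstSMul G X] (𝒳 : BornCoarse X)
    (h : ∀ g : G, 𝒳.IsMorphism 𝒳 (fun x => g • x)) (k : ℤ) :
    (SqQuot 𝒳 h).IsMorphism (SqQuot 𝒳 h) (shift X k) where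
  proper := (shift_isMorphism_sq 𝒳 k).proper
  controlled E hE := by
    change BornCoarse.Generate _ E at hE
    change BornCoarse.Generate _ _
    induction hE with
    | basic hU =>
      obtain hU | ⟨g, rfl⟩ := hU
      · exact .basic (Or.inl ((shift_isMorphism_sq 𝒳 k).controlled _ hU))
      · refine .mono (.basic (Or.inr ⟨g, rfl⟩)) ?_
        rintro _ ⟨⟨p, q⟩, hpq, rfl⟩
        have hpq : p = sqAct G X g q := hpq
        subst hpq
        rfl
    | diag =>
      refine .mono .diag ?_
      rintro _ ⟨⟨p, q⟩, hpq, rfl⟩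
      have hpq : p = q := hpq
      subst hpq
      rfl
    | mono _ hUV ih => exact .mono ih (image_mono hUV)
    | union _ _ ih₁ ih₂ => rw [image_union]; exact .union ih₁ ih₂
    | inv _ ih =>
      refine .mono (.inv ih) ?_
      rintro _ ⟨⟨p, q⟩, hpq, rfl⟩
      exact ⟨(q, p), hpq, rfl⟩
    | comp _ _ ih₁ ih₂ =>
      refine .mono (.comp ih₁ ih₂) ?_
      rintro _ ⟨⟨p, r⟩, ⟨q, hpq, hqr⟩, rfl⟩
      exact ⟨shift X k q, ⟨(p, q), hpq, rfl⟩, ⟨(q, r), hqr, rfl⟩⟩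

/-- A uniform scale: a sequence of uniform entourages which is cofinal in the uniform structure. -/
def IsUniformScale (U : ℕ → SetRel X X) : Prop :=
  (∀ n, U n ∈ 𝓤 X) ∧ ∀ V ∈ 𝓤 X, ∃ n, U n ⊆ V

end Squeezing

/-! ## Controlled Hilbert spaces -/

/-- A Hilbert space with a finitely additive projection-valued measure defined on all subsets of
`Y`. -/
structure ControlledHilbert (Y : Type u) where
  /-- the underlying Hilbert space -/
  H : Type u
  [normed : NormedAddCommGroup H]
  [inner : InnerProductSpace ℂ H]
  [complete : CompleteSpace H]
  /-- the projection-valued measure -/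
  μ : Set Y → H →L[ℂ] H
  proj : ∀ S, IsStarProjection (μ S)
  μ_univ : μ univ = 1
  μ_inter : ∀ S T, μ (S ∩ T) = μ S * μ T
  μ_union : ∀ S T, Disjoint S T → μ (S ∪ T) = μ S + μ T

attribute [instance] ControlledHilbert.normed ControlledHilbert.inner ControlledHilbert.complete

namespace ControlledHilbert

variable {Y : Type u} {Y' : Type u}

/-- `(H, μ)` is locally finite: `H(S) = μ(S) H` is finite-dimensional for every bounded `S`. -/
def IsLocallyFinite (𝒴 : BornCoarse Y) (E : ControlledHilbert Y) : Prop :=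
  ∀ S, 𝒴.IsBdd S → FiniteDimensional ℂ (E.μ S).range

/-- `(H, μ)` is determined on points: `H` is the closed span of the subspaces `H({y})`. -/
def IsDeterminedOnPoints (E : ControlledHilbert Y) : Prop :=
  (⨆ y : Y, (E.μ {y}).range).topologicalClosure = ⊤

/-- `A` is `U`-controlled if `A H(S) ⊆ H'(U[S])` for all `S`, i.e. if `μ'(T) A μ(S) = 0` whenever `T`
is disjoint from `U[S]`; it is controlled if this holds for some coarse entourage `U`. -/
def IsControlled (𝒴 : BornCoarse Y) {E E' : ControlledHilbert Y} (A : E.H →L[ℂ] E'.H) : Prop :=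
  ∃ U, 𝒴.IsEntourage U ∧ ∀ S T : Set Y, Disjoint T (U.preimage S) → E'.μ T ∘L A ∘L E.μ S = 0

/-- `A` can be approximated in norm by controlled operators. -/
def IsApprox (𝒴 : BornCoarse Y) {E E' : ControlledHilbert Y} (A : E.H →L[ℂ] E'.H) : Prop :=
  A ∈ closure {A' : E.H →L[ℂ] E'.H | IsControlled 𝒴 A'}

/-- `A : H → H'` is a locally finite operator: it factors as the coisometry `u*` onto, followed by an
operator `A₀` and the isometry `u'` from, locally finite controlled Hilbert spaces determined on
points, where `u` and `u'` are controlled.  In other words `A = A₀ ⊕ 0` for orthogonal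
decompositions of `H` and `H'` with locally finite first summands. -/
def IsLocallyFiniteOp (𝒴 : BornCoarse Y) {E E' : ControlledHilbert Y} (A : E.H →L[ℂ] E'.H) :
    Prop :=
  ∃ (F F' : ControlledHilbert Y) (u : F.H →ₗᵢ[ℂ] E.H) (u' : F'.H →ₗᵢ[ℂ] E'.H)
    (A₀ : F.H →L[ℂ] F'.H),
    F.IsLocallyFinite 𝒴 ∧ F.IsDeterminedOnPoints ∧ IsControlled 𝒴 u.toContinuousLinearMap ∧
    F'.IsLocallyFinite 𝒴 ∧ F'.IsDeterminedOnPoints ∧ IsControlled 𝒴 u'.toContinuousLinearMap ∧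
    A = u'.toContinuousLinearMap ∘L A₀ ∘L
      ContinuousLinearMap.adjoint u.toContinuousLinearMap

/-- The Roe algebra `C(Y, H, μ)`: the `C*`-subalgebra of `B(H)` generated by the operators which are
locally finite and controlled. -/
def roeAlgebra (𝒴 : BornCoarse Y) (E : ControlledHilbert Y) :
    NonUnitalStarSubalgebra ℂ (E.H →L[ℂ] E.H) :=
  (NonUnitalStarAlgebra.adjoin ℂ
    {A : E.H →L[ℂ] E.H | IsLocallyFiniteOp 𝒴 A ∧ IsControlled 𝒴 A}).topologicalClosure

/-- The push-forward `(H, f_* μ)`. -/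
def push (E : ControlledHilbert Y) (f : Y → Y') : ControlledHilbert Y' where
  H := E.H
  μ S := E.μ (f ⁻¹' S)
  proj _ := E.proj _
  μ_univ := E.μ_univ
  μ_inter _ _ := E.μ_inter _ _
  μ_union _ _ h := E.μ_union _ _ (h.preimage f)

theorem μ_mono (E : ControlledHilbert Y) {S T : Set Y} (h : S ⊆ T) : (E.μ S).range ≤ (E.μ T).range := by
  rintro _ ⟨x, rfl⟩
  refine ⟨E.μ S x, ?_⟩
  have := E.μ_inter T S
  rw [inter_eq_right.2 h] at this
  exact (congrArg (fun A : E.H →L[ℂ] E.H => A x) this).symm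

theorem IsLocallyFinite.push {𝒴 : BornCoarse Y} {𝒴' : BornCoarse Y'} {E : ControlledHilbert Y}
    (hE : E.IsLocallyFinite 𝒴) {f : Y → Y'} (hf : 𝒴.IsMorphism 𝒴' f) :
    (E.push f).IsLocallyFinite 𝒴' :=
  fun S hS => hE _ (hf.proper S hS)

theorem IsDeterminedOnPoints.push {E : ControlledHilbert Y} (hE : E.IsDeterminedOnPoints)
    (f : Y → Y') : (E.push f).IsDeterminedOnPoints := by
  refine top_le_iff.1 (hE.symm.le.trans (Submodule.topologicalClosure_mono (iSup_le fun y => ?_)))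
  refine le_trans ?_ (le_iSup (fun y' : Y' => ((E.push f).μ {y'}).range) (f y))
  exact E.μ_mono (by simp)

theorem IsControlled.push {𝒴 : BornCoarse Y} {𝒴' : BornCoarse Y'} {E E' : ControlledHilbert Y}
    {A : E.H →L[ℂ] E'.H} (hA : IsControlled 𝒴 A) {f : Y → Y'} (hf : 𝒴.IsMorphism 𝒴' f) :
    IsControlled (E := E.push f) (E' := E'.push f) 𝒴' A := by
  obtain ⟨U, hU, h⟩ := hA
  refine ⟨_, hf.controlled U hU, fun S T hST => h _ _ ?_⟩
  rw [Set.disjoint_left] at hST ⊢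
  rintro x hx ⟨y, hy, hxy⟩
  exact hST hx ⟨f y, hy, (x, y), hxy, rfl⟩

theorem IsApprox.push {𝒴 : BornCoarse Y} {𝒴' : BornCoarse Y'} {E E' : ControlledHilbert Y}
    {A : E.H →L[ℂ] E'.H} (hA : IsApprox 𝒴 A) {f : Y → Y'} (hf : 𝒴.IsMorphism 𝒴' f) :
    IsApprox (E := E.push f) (E' := E'.push f) 𝒴' A :=
  closure_mono (fun _ h => IsControlled.push h hf) hA

/-- A subset `C` of `Y` is a coarsely disjoint summand if no coarse entourage relates points of `C`
with points outside of `C`. -/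
def _root_.BornCoarse.IsSummand (𝒴 : BornCoarse Y) (C : Set Y) : Prop :=
  ∀ U, 𝒴.IsEntourage U → ∀ p ∈ U, (p.1 ∈ C ↔ p.2 ∈ C)

theorem IsControlled.comm {𝒴 : BornCoarse Y} {C : Set Y} (hC : 𝒴.IsSummand C)
    {E E' : ControlledHilbert Y} {A : E.H →L[ℂ] E'.H} (hA : IsControlled 𝒴 A) :
    A ∘L E.μ C = E'.μ C ∘L A := by
  obtain ⟨U, hU, h⟩ := hA
  have h1 : ∀ E : ControlledHilbert Y, E.μ C + E.μ Cᶜ = 1 := fun E => by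
    rw [← E.μ_union _ _ disjoint_compl_right, union_compl_self, E.μ_univ]
  have h2 : E'.μ Cᶜ ∘L A ∘L E.μ C = 0 := by
    refine h _ _ (Set.disjoint_left.2 ?_)
    rintro x hx ⟨y, hy, hxy⟩
    exact hx ((hC U hU _ hxy).2 hy)
  have h3 : E'.μ C ∘L A ∘L E.μ Cᶜ = 0 := by
    refine h _ _ (Set.disjoint_left.2 ?_)
    rintro x hx ⟨y, hy, hxy⟩
    exact hy ((hC U hU _ hxy).1 hx)
  have h4 : A ∘L E.μ C = E'.μ C ∘L A ∘L E.μ C := by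
    have : (E'.μ C + E'.μ Cᶜ) ∘L A ∘L E.μ C = A ∘L E.μ C := by rw [h1]; rfl
    exact this.symm.trans (by rw [ContinuousLinearMap.add_comp, h2, add_zero])
  have h5 : E'.μ C ∘L A = E'.μ C ∘L A ∘L E.μ C := by
    have : E'.μ C ∘L A ∘L (E.μ C + E.μ Cᶜ) = E'.μ C ∘L A := by rw [h1]; rfl
    rw [← this, ContinuousLinearMap.comp_add, ContinuousLinearMap.comp_add, h3, add_zero]
  rw [h4, h5]

theorem IsApprox.comm {𝒴 : BornCoarse Y} {C : Set Y} (hC : 𝒴.IsSummand C)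
    {E E' : ControlledHilbert Y} {A : E.H →L[ℂ] E'.H} (hA : IsApprox 𝒴 A) :
    A ∘L E.μ C = E'.μ C ∘L A := by
  have hcl : IsClosed {A : E.H →L[ℂ] E'.H | A ∘L E.μ C = E'.μ C ∘L A} :=
    isClosed_eq (by fun_prop) (by fun_prop)
  exact closure_minimal (fun A h => IsControlled.comm hC h) hcl hA

end ControlledHilbert

/-! ## Coarse `K`-homology in degree zero -/

open ControlledHilbert

/-- A projection in the `C*`-category of locally finite `Y`-controlled Hilbert spaces determined on
points, whose morphisms are the bounded operators which can be approximated by controlled ones. -/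
structure KGen {Y : Type u} (𝒴 : BornCoarse Y) where
  /-- the object -/
  obj : ControlledHilbert Y
  locFin : obj.IsLocallyFinite 𝒴
  det : obj.IsDeterminedOnPoints
  /-- the projection -/
  q : obj.H →L[ℂ] obj.H
  approx : IsApprox 𝒴 q
  isProj : IsStarProjection q

namespace KGen

variable {Y : Type u} {Y' : Type u} {𝒴 : BornCoarse Y} {𝒴' : BornCoarse Y'}

/-- The projection `c` is unitarily equivalent to the orthogonal sum of `a` and `b`: there are
partial isometries `v`, `w` in the `C*`-category with `v* v = a`, `w* w = b` and `c` is the sum of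
the orthogonal projections `v v*` and `w w*`. -/
def OrthSum (a b c : KGen 𝒴) : Prop :=
  ∃ (v : a.obj.H →L[ℂ] c.obj.H) (w : b.obj.H →L[ℂ] c.obj.H), IsApprox 𝒴 v ∧ IsApprox 𝒴 w ∧
    v.adjoint ∘L v = a.q ∧ w.adjoint ∘L w = b.q ∧ v.adjoint ∘L w = 0 ∧
    v ∘L v.adjoint + w ∘L w.adjoint = c.q

/-- The action of a morphism of bornological coarse spaces. -/
def push (a : KGen 𝒴) {f : Y → Y'} (hf : 𝒴.IsMorphism 𝒴' f) : KGen 𝒴' where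
  obj := a.obj.push f
  locFin := a.locFin.push hf
  det := a.det.push f
  q := a.q
  approx := a.approx.push hf
  isProj := a.isProj

/-- The rank of the component of the projection `a` at `C`. -/
def rankAt (C : Set Y) (a : KGen 𝒴) : ℕ := Module.finrank ℂ (a.q ∘L a.obj.μ C).range

theorem rankAt_add {C : Set Y} (hb : 𝒴.IsBdd C) (hC : 𝒴.IsSummand C) {a b c : KGen 𝒴}
    (h : OrthSum a b c) : c.rankAt C = a.rankAt C + b.rankAt C := by
  obtain ⟨v, w, hv, hw, hvv, hww, hvw, hc⟩ := h
  have hwv : w.adjoint ∘L v = 0 := by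
    rw [← ContinuousLinearMap.adjoint_adjoint v, ← ContinuousLinearMap.adjoint_comp, hvw, map_zero]
  have fin : ∀ a : KGen 𝒴, Module.Finite ℂ (a.q ∘L a.obj.μ C).range := fun a => by
    have := a.locFin C hb
    have e : (a.q ∘L a.obj.μ C).range = (a.obj.μ C).range.map (a.q : a.obj.H →ₗ[ℂ] a.obj.H) := by
      ext x
      simp
    rw [e]
    infer_instance
  have idem : ∀ (a : KGen 𝒴) (x : a.obj.H), a.q (a.q x) = a.q x := fun a x =>
    congrArg (fun A : a.obj.H →L[ℂ] a.obj.H => A x) a.isProj.isIdempotentElem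
  have comv := IsApprox.comm hC hv
  have comw := IsApprox.comm hC hw
  have selfadj : ∀ E : ControlledHilbert Y, (E.μ C).adjoint = E.μ C := fun E =>
    (E.proj C).isSelfAdjoint
  have comv' : a.obj.μ C ∘L v.adjoint = v.adjoint ∘L c.obj.μ C := by
    have := congrArg ContinuousLinearMap.adjoint comv
    rwa [ContinuousLinearMap.adjoint_comp, ContinuousLinearMap.adjoint_comp, selfadj, selfadj] at this
  have comw' : b.obj.μ C ∘L w.adjoint = w.adjoint ∘L c.obj.μ C := by
    have := congrArg ContinuousLinearMap.adjoint comw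
    rwa [ContinuousLinearMap.adjoint_comp, ContinuousLinearMap.adjoint_comp, selfadj, selfadj] at this
  have p1 : ∀ x, v.adjoint (v x) = a.q x := fun x => congrArg (fun A : a.obj.H →L[ℂ] a.obj.H => A x) hvv
  have p2 : ∀ x, w.adjoint (w x) = b.q x := fun x => congrArg (fun A : b.obj.H →L[ℂ] b.obj.H => A x) hww
  have p3 : ∀ x, v.adjoint (w x) = 0 := fun x => congrArg (fun A : b.obj.H →L[ℂ] a.obj.H => A x) hvw
  have p4 : ∀ x, w.adjoint (v x) = 0 := fun x => congrArg (fun A : a.obj.H →L[ℂ] b.obj.H => A x) hwv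
  have p5 : ∀ x, v (v.adjoint x) + w (w.adjoint x) = c.q x := fun x =>
    congrArg (fun A : c.obj.H →L[ℂ] c.obj.H => A x) hc
  have p6 : ∀ x, v (a.obj.μ C x) = c.obj.μ C (v x) := fun x =>
    congrArg (fun A : a.obj.H →L[ℂ] c.obj.H => A x) comv
  have p7 : ∀ x, w (b.obj.μ C x) = c.obj.μ C (w x) := fun x =>
    congrArg (fun A : b.obj.H →L[ℂ] c.obj.H => A x) comw
  have p8 : ∀ x, a.obj.μ C (v.adjoint x) = v.adjoint (c.obj.μ C x) := fun x =>
    congrArg (fun A : c.obj.H →L[ℂ] a.obj.H => A x) comv'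
  have p9 : ∀ x, b.obj.μ C (w.adjoint x) = w.adjoint (c.obj.μ C x) := fun x =>
    congrArg (fun A : c.obj.H →L[ℂ] b.obj.H => A x) comw'
  let φ : (a.q ∘L a.obj.μ C).range × (b.q ∘L b.obj.μ C).range →ₗ[ℂ] c.obj.H :=
    LinearMap.coprod ((v : a.obj.H →ₗ[ℂ] c.obj.H) ∘ₗ Submodule.subtype _)
      ((w : b.obj.H →ₗ[ℂ] c.obj.H) ∘ₗ Submodule.subtype _)
  have hφ : ∀ x y, φ (x, y) = v x + w y := fun x y => rfl
  have inj : Function.Injective φ := by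
    rw [← LinearMap.ker_eq_bot, LinearMap.ker_eq_bot']
    rintro ⟨⟨x, x', hx⟩, ⟨y, y', hy⟩⟩ h0
    rw [hφ] at h0
    have hx' : a.q x = x := by rw [← hx]; exact idem a _
    have hy' : b.q y = y := by rw [← hy]; exact idem b _
    have e1 := congrArg v.adjoint h0
    have e2 := congrArg w.adjoint h0
    simp only [map_add, p1, p2, p3, p4, map_zero, add_zero, zero_add, hx', hy'] at e1 e2
    exact Prod.ext (Subtype.ext e1) (Subtype.ext e2)
  have ran : φ.range = (c.q ∘L c.obj.μ C).range := by
    apply le_antisymm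
    · rintro _ ⟨⟨⟨x, x', hx⟩, ⟨y, y', hy⟩⟩, rfl⟩
      refine ⟨v x' + w y', ?_⟩
      have hx : a.q (a.obj.μ C x') = x := hx
      have hy : b.q (b.obj.μ C y') = y := hy
      change c.q (c.obj.μ C (v x' + w y')) = v x + w y
      rw [map_add, ← p6, ← p7, ← hx, ← hy, ← p5]
      simp only [map_add, p1, p2, p3, p4, add_zero, zero_add]
    · rintro _ ⟨z, rfl⟩
      refine ⟨(⟨_, v.adjoint z, rfl⟩, ⟨_, w.adjoint z, rfl⟩), ?_⟩
      rw [hφ]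
      change v (a.q (a.obj.μ C _)) + w (b.q (b.obj.μ C _)) = c.q (c.obj.μ C z)
      rw [p8, p9, ← p1, ← p2, ← idem c, ← p5, ← p5]
      simp only [map_add, p1, p2, p3, p4, add_zero, zero_add]
  have := fin a
  have := fin b
  unfold rankAt
  rw [← ran, LinearMap.finrank_range_of_inj inj, Module.finrank_prod]

end KGen

/-- The relations `[a] + [b] = [c]` whenever `c` is an orthogonal sum of `a` and `b`. -/
def KX0Rel {Y : Type u} (𝒴 : BornCoarse Y) : AddSubgroup (FreeAbelianGroup (KGen 𝒴)) :=
  AddSubgroup.closure {x | ∃ a b c : KGen 𝒴, KGen.OrthSum a b c ∧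
    x = FreeAbelianGroup.of a + FreeAbelianGroup.of b - FreeAbelianGroup.of c}

/-- `π₀ K𝒳(Y)`, the group `K₀` of the `C*`-category of locally finite `Y`-controlled Hilbert spaces
determined on points: the abelian group generated by the projections in this category, where the
class of an orthogonal sum is the sum of the classes. -/
abbrev KX0 {Y : Type u} (𝒴 : BornCoarse Y) : Type (u + 1) :=
  FreeAbelianGroup (KGen 𝒴) ⧸ KX0Rel 𝒴

namespace KX0

variable {Y : Type u} {Y' : Type u} {𝒴 : BornCoarse Y} {𝒴' : BornCoarse Y'}

/-- The class of a projection. -/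
def mk (a : KGen 𝒴) : KX0 𝒴 := QuotientAddGroup.mk (FreeAbelianGroup.of a)

/-- The homomorphism `f_*` induced by a morphism `f` of bornological coarse spaces. -/
def map {f : Y → Y'} (hf : 𝒴.IsMorphism 𝒴' f) : KX0 𝒴 →+ KX0 𝒴' :=
  QuotientAddGroup.map _ _ (FreeAbelianGroup.map fun a => a.push hf) (by
    rw [KX0Rel, AddSubgroup.closure_le]
    rintro _ ⟨a, b, c, ⟨v, w, hv, hw, h1, h2, h3, h4⟩, rfl⟩
    refine AddSubgroup.subset_closure ⟨a.push hf, b.push hf, c.push hf,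
      ⟨v, w, hv.push hf, hw.push hf, h1, h2, h3, h4⟩, ?_⟩
    simp)

/-- The trace of the component of a class at a bounded coarsely disjoint summand `C` of `Y`: the class
of a projection `q` is sent to the trace (i.e. the rank) of the restriction of `q` to the
finite-dimensional space `H(C)`. -/
def traceAt {C : Set Y} (hb : 𝒴.IsBdd C) (hC : 𝒴.IsSummand C) : KX0 𝒴 →+ ℤ :=
  QuotientAddGroup.lift _ (FreeAbelianGroup.lift fun a => (a.rankAt C : ℤ)) (by
    rw [KX0Rel, AddSubgroup.closure_le]
    rintro _ ⟨a, b, c, h, rfl⟩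
    simp [KGen.rankAt_add hb hC h])

/-- The class in `π₀ K𝒳(Y)` of a projection `P` on a (not necessarily locally finite) controlled
Hilbert space `E` is `c`: the projection `P` is Murray-von Neumann equivalent, by a partial isometry
which can be approximated by controlled operators, to a projection on a locally finite object which
represents `c`. -/
def IsClassOf {E : ControlledHilbert Y} (P : E.H →L[ℂ] E.H) (c : KX0 𝒴) : Prop :=
  ∃ (a : KGen 𝒴) (v : a.obj.H →L[ℂ] E.H), IsApprox 𝒴 v ∧ v.adjoint ∘L v = a.q ∧
    v ∘L v.adjoint = P ∧ c = mk a

end KX0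

/-! ## The data defined by the measure -/

section Measure

/-- The multiplication operator by the characteristic function of the measurable set `S`. -/
def mulInd {Ω : Type u} [MeasurableSpace Ω] (m : Measure Ω) {S : Set Ω} (hS : MeasurableSet S) :
    Lp ℂ 2 m →L[ℂ] Lp ℂ 2 m :=
  LinearMap.mkContinuous
    { toFun := fun f => ((Lp.memLp f).indicator hS).toLp (S.indicator f)
      map_add' := fun f g => by
        refine Lp.ext ?_
        filter_upwards [((Lp.memLp (f + g)).indicator hS).coeFn_toLp,
          ((Lp.memLp f).indicator hS).coeFn_toLp, ((Lp.memLp g).indicator hS).coeFn_toLp,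
          Lp.coeFn_add f g, Lp.coeFn_add (((Lp.memLp f).indicator hS).toLp (S.indicator f))
            (((Lp.memLp g).indicator hS).toLp (S.indicator g))] with x h1 h2 h3 h4 h5
        rw [h1, h5, Pi.add_apply, h2, h3]
        by_cases hx : x ∈ S
        · simp only [indicator_of_mem hx, h4, Pi.add_apply]
        · simp only [indicator_of_notMem hx, add_zero]
      map_smul' := fun c f => by
        refine Lp.ext ?_
        filter_upwards [((Lp.memLp (c • f)).indicator hS).coeFn_toLp,
          ((Lp.memLp f).indicator hS).coeFn_toLp, Lp.coeFn_smul c f,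
          Lp.coeFn_smul c (((Lp.memLp f).indicator hS).toLp (S.indicator f))] with x h1 h2 h3 h4
        rw [h1, RingHom.id_apply, h4, Pi.smul_apply, h2]
        by_cases hx : x ∈ S
        · simp only [indicator_of_mem hx, h3, Pi.smul_apply]
        · simp only [indicator_of_notMem hx, smul_zero] }
    1 (fun f => by
      rw [one_mul]
      refine Lp.norm_le_norm_of_ae_le ?_
      filter_upwards [((Lp.memLp f).indicator hS).coeFn_toLp] with x hx
      change ‖(((Lp.memLp f).indicator hS).toLp (S.indicator f)) x‖ ≤ _
      rw [hx]
      exact norm_indicator_le_norm_self _ _)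

theorem mulInd_coe {Ω : Type u} [MeasurableSpace Ω] (m : Measure Ω) {S : Set Ω}
    (hS : MeasurableSet S) (f : Lp ℂ 2 m) : mulInd m hS f =ᵐ[m] S.indicator f :=
  ((Lp.memLp f).indicator hS).coeFn_toLp

theorem mulInd_isStarProjection {Ω : Type u} [MeasurableSpace Ω] (m : Measure Ω) {S : Set Ω}
    (hS : MeasurableSet S) : IsStarProjection (mulInd m hS) where
  isIdempotentElem := by
    refine ContinuousLinearMap.ext fun f => Lp.ext ?_
    filter_upwards [mulInd_coe m hS f, mulInd_coe m hS (mulInd m hS f)] with x h1 h2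
    change mulInd m hS (mulInd m hS f) x = mulInd m hS f x
    rw [h2, h1]
    by_cases hx : x ∈ S <;> simp [hx, h1]
  isSelfAdjoint := by
    rw [ContinuousLinearMap.isSelfAdjoint_iff_isSymmetric]
    intro f g
    change ⟪mulInd m hS f, g⟫_ℂ = ⟪f, mulInd m hS g⟫_ℂ
    rw [L2.inner_def, L2.inner_def]
    refine integral_congr_ae ?_
    filter_upwards [mulInd_coe m hS f, mulInd_coe m hS g] with x h1 h2
    rw [h1, h2]
    by_cases hx : x ∈ S <;> simp [hx]

variable {X : Type u} [MeasurableSpace X]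

/-- The product `ν̂` on `ℤ × X` of the counting measure of `ℤ` with `ν`. -/
abbrev nuHat (ν : Measure X) : Measure (ℤ × X) := (Measure.count : Measure ℤ).prod ν

/-- The subspace of `Ĥ = L²(ℤ × X, ν̂)` of the functions which are (almost everywhere) constant on the
components `{n} × X`. -/
def fibrewiseConst (ν : Measure X) : Submodule ℂ (Lp ℂ 2 (nuHat ν)) where
  carrier := {f | ∃ c : ℤ → ℂ, ∀ᵐ p ∂(nuHat ν), f p = c p.1}
  add_mem' := by
    rintro f g ⟨c, hc⟩ ⟨d, hd⟩
    refine ⟨c + d, ?_⟩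
    filter_upwards [hc, hd, Lp.coeFn_add f g] with p h1 h2 h3
    rw [h3, Pi.add_apply, h1, h2, Pi.add_apply]
  zero_mem' := ⟨0, by
    filter_upwards [Lp.coeFn_zero ℂ 2 (nuHat ν)] with p hp
    rw [hp]; rfl⟩
  smul_mem' := by
    rintro a f ⟨c, hc⟩
    refine ⟨a • c, ?_⟩
    filter_upwards [hc, Lp.coeFn_smul a f] with p h1 h2
    rw [h2, Pi.smul_apply, h1, Pi.smul_apply]

theorem fibrewiseConst_isClosed (ν : Measure X) :
    IsClosed (fibrewiseConst ν : Set (Lp ℂ 2 (nuHat ν))) := by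
  refine IsSeqClosed.isClosed fun f g hf hg => ?_
  choose c hc using hf
  obtain ⟨ns, -, hns⟩ := (tendstoInMeasure_of_tendsto_Lp hg).exists_seq_tendsto_ae
  refine ⟨fun n => limUnder atTop fun k => c (ns k) n, ?_⟩
  filter_upwards [hns, ae_all_iff.2 hc] with p h1 h2
  simp only [h2] at h1
  exact h1.limUnder_eq.symm

instance (ν : Measure X) : CompleteSpace (fibrewiseConst ν) :=
  (fibrewiseConst_isClosed ν).completeSpace_coe

/-- The Drutu-Nowak projection `P̂`: the orthogonal projection of `Ĥ` onto the subspace of functions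
which are constant on the components `{n} × X`. -/
def drutuNowak (ν : Measure X) : Lp ℂ 2 (nuHat ν) →L[ℂ] Lp ℂ 2 (nuHat ν) :=
  (fibrewiseConst ν).starProjection

variable {G : Type v} [Group G] [MulAction G X]

/-- The unitary representation `(ρ(g) f)(x) = f(g⁻¹ x)` of `G` on `L²(X, ν)`. -/
def rho [MeasurableConstSMul G X] (ν : Measure X) [SMulInvariantMeasure G X ν] (g : G) :
    Lp ℂ 2 ν →ₗᵢ[ℂ] Lp ℂ 2 ν :=
  Lp.compMeasurePreservingₗᵢ ℂ (fun x => g⁻¹ • x) (measurePreserving_smul g⁻¹ ν)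

variable (G) in
/-- The subspace of `G`-invariant vectors in `L²(X, ν)`. -/
def invariants [MeasurableConstSMul G X] (ν : Measure X) [SMulInvariantMeasure G X ν] :
    Submodule ℂ (Lp ℂ 2 ν) :=
  ⨅ g : G, LinearMap.eqLocus (rho ν g).toLinearMap LinearMap.id

variable (G) in
/-- The action of `G` on `H = L²(X, ν)` has a spectral gap: there are a finite subset `S` of `G` and
`κ` in `(0, 1)` with `max_{s ∈ S} ‖h - ρ(s) h‖ ≥ κ ‖h‖` for all `h` orthogonal to the invariants. -/
def HasSpectralGap [MeasurableConstSMul G X] (ν : Measure X) [SMulInvariantMeasure G X ν] : Prop :=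
  ∃ (S : Finset G) (κ : ℝ), 0 < κ ∧ κ < 1 ∧ ∀ h ∈ (invariants G ν)ᗮ, ∃ s ∈ S, κ * ‖h‖ ≤ ‖h - rho ν s h‖

/-- The choices turning `Ĥ` into a controlled Hilbert space: a coarse entourage `V` of `Sq(X)` all of
whose components `V_n` are uniform entourages of `X`, a measurable `V²`-bounded partition `(B_i)` of
a subset of full measure of `ℤ × X` into sets of positive measure, and a locally finite `V⁵`-dense
family of base points `b_i ∈ B_i`.  Here `V²`-bounded is used in the weak form `B_i ⊆ V²[y]` for
some `y`; for non-empty `B_i` it follows from `B_i × B_i ⊆ V²`. -/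
structure PartitionData [UniformSpace X] (𝒳 : BornCoarse X) (ν : Measure X) (ι : Type w) where
  V : SetRel (ℤ × X) (ℤ × X)
  V_entourage : (Sq 𝒳).IsEntourage V
  V_uniform : ∀ n, compAt V n ∈ 𝓤 X
  B : ι → Set (ℤ × X)
  B_meas : ∀ i, MeasurableSet (B i)
  B_disj : Pairwise (Function.onFun Disjoint B)
  B_full : nuHat ν (⋃ i, B i)ᶜ = 0
  B_bdd : ∀ i, ∃ y, B i ⊆ (V ○ V).preimage {y}
  B_pos : ∀ i, 0 < nuHat ν (B i)
  b : ι → ℤ × X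
  b_mem : ∀ i, b i ∈ B i
  b_locFin : ∀ S, (Sq 𝒳).IsBdd S → {i | b i ∈ S}.Finite
  b_dense : ∀ y, ∃ i, (y, b i) ∈ V ○ V ○ V ○ V ○ V

namespace PartitionData

variable [UniformSpace X] {𝒳 : BornCoarse X} {ν : Measure X} {ι : Type w}

theorem countable [SFinite ν] (D : PartitionData 𝒳 ν ι) : Countable ι := by
  have h := Measure.countable_meas_pos_of_disjoint_iUnion (μ := nuHat ν) D.B_meas D.B_disj
  have : {i | 0 < nuHat ν (D.B i)} = univ := eq_univ_of_forall D.B_pos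
  rw [this] at h
  exact countable_univ_iff.1 h

/-- The union of the `B_i` with base point `b_i` in `S`. -/
def cells (D : PartitionData 𝒳 ν ι) (S : Set (ℤ × X)) : Set (ℤ × X) := ⋃ i ∈ D.b ⁻¹' S, D.B i

theorem cells_meas [SFinite ν] (D : PartitionData 𝒳 ν ι) (S : Set (ℤ × X)) :
    MeasurableSet (D.cells S) :=
  have := D.countable
  MeasurableSet.biUnion (to_countable _) fun i _ => D.B_meas i

theorem mem_cells (D : PartitionData 𝒳 ν ι) {i : ι} {x : ℤ × X} (hx : x ∈ D.B i)
    (S : Set (ℤ × X)) : x ∈ D.cells S ↔ D.b i ∈ S := by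
  simp only [cells, mem_iUnion, exists_prop]
  constructor
  · rintro ⟨j, hj, hxj⟩
    obtain rfl : i = j := by
      by_contra hne
      exact Set.disjoint_left.1 (D.B_disj hne) hx hxj
    exact hj
  · exact fun h => ⟨i, h, hx⟩

/-- The controlled Hilbert space `(Ĥ, μ̂)` with `μ̂ = ∑ᵢ ν̂(Bᵢ) δ_{bᵢ}`, i.e. `μ̂(S)` is the (strongly
convergent) sum of the projections `ν̂(B_i)` over all `i` with `b_i ∈ S`, which is the multiplication
operator by the characteristic function of the union of these `B_i`. -/
def hilbert [SFinite ν] (D : PartitionData 𝒳 ν ι) : ControlledHilbert (ℤ × X) where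
  H := Lp ℂ 2 (nuHat ν)
  μ S := mulInd (nuHat ν) (D.cells_meas S)
  proj S := mulInd_isStarProjection _ _
  μ_univ := by
    refine ContinuousLinearMap.ext fun f => Lp.ext ?_
    have hf : ∀ᵐ p ∂(nuHat ν), p ∈ ⋃ i, D.B i := D.B_full
    filter_upwards [mulInd_coe (nuHat ν) (D.cells_meas univ) f, hf] with x h1 h2
    obtain ⟨i, hi⟩ := mem_iUnion.1 h2
    rw [h1, indicator_of_mem ((D.mem_cells hi _).2 (mem_univ _))]
    rfl
  μ_inter S T := by
    refine ContinuousLinearMap.ext fun f => Lp.ext ?_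
    have hf : ∀ᵐ p ∂(nuHat ν), p ∈ ⋃ i, D.B i := D.B_full
    filter_upwards [mulInd_coe (nuHat ν) (D.cells_meas (S ∩ T)) f,
      mulInd_coe (nuHat ν) (D.cells_meas T) f,
      mulInd_coe (nuHat ν) (D.cells_meas S) (mulInd (nuHat ν) (D.cells_meas T) f), hf]
      with x h1 h2 h3 h4
    obtain ⟨i, hi⟩ := mem_iUnion.1 h4
    change _ = mulInd (nuHat ν) (D.cells_meas S) (mulInd (nuHat ν) (D.cells_meas T) f) x
    rw [h1, h3]
    have e := fun S' => D.mem_cells hi S'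
    by_cases hS : D.b i ∈ S
    · by_cases hT : D.b i ∈ T
      · rw [indicator_of_mem ((e (S ∩ T)).2 ⟨hS, hT⟩), indicator_of_mem ((e _).2 hS), h2,
          indicator_of_mem ((e _).2 hT)]
      · rw [indicator_of_notMem fun h => hT ((e (S ∩ T)).1 h).2, indicator_of_mem ((e _).2 hS), h2,
          indicator_of_notMem fun h => hT ((e _).1 h)]
    · rw [indicator_of_notMem fun h => hS ((e (S ∩ T)).1 h).1, indicator_of_notMem fun h => hS ((e _).1 h)]
  μ_union S T hST := by
    refine ContinuousLinearMap.ext fun f => Lp.ext ?_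
    have hf : ∀ᵐ p ∂(nuHat ν), p ∈ ⋃ i, D.B i := D.B_full
    filter_upwards [mulInd_coe (nuHat ν) (D.cells_meas (S ∪ T)) f,
      mulInd_coe (nuHat ν) (D.cells_meas T) f, mulInd_coe (nuHat ν) (D.cells_meas S) f,
      Lp.coeFn_add (mulInd (nuHat ν) (D.cells_meas S) f) (mulInd (nuHat ν) (D.cells_meas T) f), hf]
      with x h1 h2 h3 h4 h5
    obtain ⟨i, hi⟩ := mem_iUnion.1 h5
    have e := fun S' => D.mem_cells hi S'
    rw [_root_.add_apply, h1, h4, Pi.add_apply, h2, h3]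
    by_cases hS : D.b i ∈ S
    · rw [indicator_of_mem ((e (S ∪ T)).2 (Or.inl hS)), indicator_of_mem ((e _).2 hS),
        indicator_of_notMem fun h => Set.disjoint_left.1 hST hS ((e _).1 h), add_zero]
    · by_cases hT : D.b i ∈ T
      · rw [indicator_of_mem ((e (S ∪ T)).2 (Or.inr hT)), indicator_of_mem ((e _).2 hT),
          indicator_of_notMem fun h => hS ((e _).1 h), zero_add]
      · rw [indicator_of_notMem fun h => ((e (S ∪ T)).1 h).elim hS hT,
          indicator_of_notMem fun h => hS ((e _).1 h),
          indicator_of_notMem fun h => hT ((e _).1 h), zero_add]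

end PartitionData

end Measure

/-! ## The components of the squeezing space -/

section Components

variable {X : Type u} [UniformSpace X] {G : Type v} [Group G] [MulAction G X]
  [UniformContinuousConstSMul G X]

/-- The component `{n} × X` of the squeezing space. -/
def component (X : Type u) (n : ℤ) : Set (ℤ × X) := {p | p.1 = n}

theorem component_isSummand (𝒳 : BornCoarse X)
    (h : ∀ g : G, 𝒳.IsMorphism 𝒳 (fun x => g • x)) (n : ℤ) :
    (SqQuot 𝒳 h).IsSummand (component X n) := by
  have key : ∀ U, (SqQuot 𝒳 h).IsEntourage U → ∀ p ∈ U, p.1.1 = p.2.1 := by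
    intro U hU
    change BornCoarse.Generate _ U at hU
    induction hU with
    | basic hU =>
      obtain hU | ⟨g, rfl⟩ := hU
      · obtain ⟨⟨U, -, hE⟩, -⟩ := (isSqEntourage_iff 𝒳 _).1 hU
        exact fun p hp => (hE p hp).1
      · rintro ⟨p, q⟩ hpq
        have hpq : p = sqAct G X g q := hpq
        subst hpq
        rfl
    | diag =>
      rintro ⟨p, q⟩ hpq
      exact congrArg Prod.fst (show p = q from hpq)
    | mono _ hUV ih => exact fun p hp => ih p (hUV hp)
    | union _ _ ih₁ ih₂ => exact fun p hp => hp.elim (ih₁ p) (ih₂ p)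
    | inv _ ih => exact fun p hp => (ih p.swap hp).symm
    | comp _ _ ih₁ ih₂ =>
      rintro p ⟨q, h1, h2⟩
      exact (ih₁ _ h1).trans (ih₂ _ h2)
  intro U hU p hp
  simp only [component, mem_ofPred_eq, key U hU p hp]

theorem component_isBdd (𝒳 : BornCoarse X) (hb : 𝒳.IsBdd univ)
    (h : ∀ g : G, 𝒳.IsMorphism 𝒳 (fun x => g • x)) (n : ℤ) :
    (SqQuot 𝒳 h).IsBdd (component X n) :=
  (sqBornology_isBounded 𝒳 _).2 ⟨{n}, univ, finite_singleton n, hb, fun _ hp => ⟨hp, mem_univ _⟩⟩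

end Components

end

noncomputable section

open ContinuousLinearMap

variable {Y Y' : Type u} {𝒴 : BornCoarse Y} {E E' E'' : ControlledHilbert Y}

/-! The heart of the matter is that the spectral gap makes the projection `drutuNowak ν` a norm
limit of controlled operators. Let `T` be the average of `(1 + ρ̂(s)) / 2` over the finite set `S`
of the gap, where `ρ̂` is the fibrewise action on `L²(ℤ × X)`. By ergodicity the invariants in
`L²(X, ν)` are the constants, so every slice of a function orthogonal to the fibrewise constant
functions is orthogonal to the invariants. There the gap and the parallelogram law bound `T` by a
constant `c < 1` which is the same for all slices. Since `T` fixes the fibrewise constant functions,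
`T ^ k` converges in norm to the projection (`exists_tendsto_drutuNowak`). Each `ρ̂(g)` is
controlled by the entourage of `g` thickened by the cells of the partition, hence so are polynomials
in `T` (`isApprox_drutuNowak`).

The approximants need not be locally finite. Local finiteness comes from the subspace `K` of
functions constant on the cells: it is closed, invariant under the projection-valued measure,
determined on points, and locally finite because a bounded set contains only finitely many base
points. Every cell lies in one component, so `K` contains all fibrewise constant functions.
Compressing the approximants to `K` puts the projection into the Roe algebra
(`mem_roeAlgebra_of_isApprox`).

The compression to `K` also represents the class. The class is unique since two representatives are
both equivalent to the projection, hence to each other. Shift invariance holds because translation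
commutes with the projection and is controlled as a map into the push-forward. The trace at `{n} ×
X` is one because the constants on that component form a line.

Partitions exist by cutting the component at `n` into finitely many pieces subordinate to the `n`-th
entourage of a decreasing basis of the uniformity. -/

theorem mem_closure_of_continuous {α β : Type*} [TopologicalSpace α] [TopologicalSpace β]
    {f : α → β} (hf : Continuous f) {s : Set α} {t : Set β} (h : ∀ a ∈ s, f a ∈ closure t)
    {a : α} (ha : a ∈ closure s) : f a ∈ closure t :=
  closure_minimal (fun a ha => h a ha) (isClosed_closure.preimage hf) ha

/-! ### Calculus of controlled and approximable operators -/

namespace ControlledHilbert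

theorem μ_empty (E : ControlledHilbert Y) : E.μ ∅ = 0 := by
  simpa using E.μ_union ∅ ∅ (disjoint_empty _)

theorem adjoint_μ (E : ControlledHilbert Y) (S : Set Y) : (E.μ S).adjoint = E.μ S :=
  (E.proj S).isSelfAdjoint

theorem μ_add_compl (E : ControlledHilbert Y) (S : Set Y) : E.μ S + E.μ Sᶜ = 1 := by
  rw [← E.μ_union _ _ disjoint_compl_right, union_compl_self, E.μ_univ]

theorem μ_comp_eq_self {A : E.H →L[ℂ] E'.H} {S T : Set Y} (h : E'.μ Tᶜ ∘L A ∘L E.μ S = 0) :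
    E'.μ T ∘L A ∘L E.μ S = A ∘L E.μ S := by
  have : (E'.μ T + E'.μ Tᶜ) ∘L A ∘L E.μ S = A ∘L E.μ S := by rw [μ_add_compl]; rfl
  rw [add_comp, h, add_zero] at this
  exact this

/-- `A` maps `H(S)` into `H'(U[S])`, so the projection onto `H'(U[S])` can be inserted between `B`
and `A`; then `B` only sees `U[S]`. -/
theorem IsControlled.comp {B : E'.H →L[ℂ] E''.H} {A : E.H →L[ℂ] E'.H}
    (hB : IsControlled 𝒴 B) (hA : IsControlled 𝒴 A) : IsControlled 𝒴 (B ∘L A) := by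
  obtain ⟨U', hU', hB⟩ := hB
  obtain ⟨U, hU, hA⟩ := hA
  refine ⟨U' ○ U, 𝒴.comp hU' hU, fun S T hST => ?_⟩
  have h1 : E'.μ (U.preimage S) ∘L A ∘L E.μ S = A ∘L E.μ S :=
    μ_comp_eq_self (hA _ _ disjoint_compl_left)
  have h2 : E''.μ T ∘L B ∘L E'.μ (U.preimage S) = 0 := by
    refine hB _ _ (hST.mono_right ?_)
    rintro x ⟨y, ⟨z, hz, hyz⟩, hxy⟩
    exact ⟨z, hz, y, hxy, hyz⟩
  calc E''.μ T ∘L (B ∘L A) ∘L E.μ S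
      = (E''.μ T ∘L B ∘L E'.μ (U.preimage S)) ∘L A ∘L E.μ S := by
        simp only [comp_assoc]; rw [h1]
    _ = 0 := by rw [h2, zero_comp]

theorem IsControlled.adjoint {A : E.H →L[ℂ] E'.H} (hA : IsControlled 𝒴 A) :
    IsControlled 𝒴 A.adjoint := by
  obtain ⟨U, hU, hA⟩ := hA
  refine ⟨U.inv, 𝒴.inv hU, fun S T hST => ?_⟩
  have h := hA T S (by
    rw [Set.disjoint_left] at hST ⊢
    rintro x hx ⟨y, hy, hxy⟩
    exact hST hy ⟨x, hx, hxy⟩)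
  have := congrArg ContinuousLinearMap.adjoint h
  rw [adjoint_comp, adjoint_comp, adjoint_μ, adjoint_μ, map_zero] at this
  simpa only [comp_assoc] using this

theorem IsControlled.add {A B : E.H →L[ℂ] E'.H} (hA : IsControlled 𝒴 A)
    (hB : IsControlled 𝒴 B) : IsControlled 𝒴 (A + B) := by
  obtain ⟨U, hU, hA⟩ := hA
  obtain ⟨U', hU', hB⟩ := hB
  refine ⟨U ∪ U', 𝒴.union hU hU', fun S T hST => ?_⟩
  rw [add_comp, comp_add, hA S T (hST.mono_right ?_), hB S T (hST.mono_right ?_), add_zero]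
  · rintro x ⟨y, hy, hxy⟩; exact ⟨y, hy, Or.inr hxy⟩
  · rintro x ⟨y, hy, hxy⟩; exact ⟨y, hy, Or.inl hxy⟩

theorem IsControlled.smul {A : E.H →L[ℂ] E'.H} (hA : IsControlled 𝒴 A) (c : ℂ) :
    IsControlled 𝒴 (c • A) := by
  obtain ⟨U, hU, hA⟩ := hA
  exact ⟨U, hU, fun S T hST => by rw [smul_comp, comp_smul, hA S T hST, smul_zero]⟩

variable (𝒴 E) in
theorem isControlled_id : IsControlled 𝒴 (ContinuousLinearMap.id ℂ E.H) := by
  refine ⟨SetRel.id, 𝒴.diag, fun S T hST => ?_⟩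
  have : T ∩ S = ∅ := by
    rw [← Set.disjoint_iff_inter_eq_empty]
    refine hST.mono_right ?_
    intro x hx
    exact ⟨x, hx, rfl⟩
  rw [id_comp, ← ContinuousLinearMap.mul_def, ← E.μ_inter, this, μ_empty]

variable (𝒴 E E') in
theorem isControlled_zero : IsControlled 𝒴 (0 : E.H →L[ℂ] E'.H) :=
  ⟨SetRel.id, 𝒴.diag, fun S T _ => by rw [zero_comp, comp_zero]⟩

theorem IsControlled.sum {α : Type*} (s : Finset α) {A : α → E.H →L[ℂ] E'.H}
    (hA : ∀ i ∈ s, IsControlled 𝒴 (A i)) : IsControlled 𝒴 (∑ i ∈ s, A i) :=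
  Finset.sum_induction _ _ (fun _ _ => IsControlled.add) (isControlled_zero 𝒴 E E') hA

theorem IsControlled.pow {A : E.H →L[ℂ] E.H} (hA : IsControlled 𝒴 A) (k : ℕ) :
    IsControlled 𝒴 (A ^ k) := by
  induction k with
  | zero => exact isControlled_id 𝒴 E
  | succ k ih => rw [pow_succ]; exact ih.comp hA

theorem IsControlled.isApprox {A : E.H →L[ℂ] E'.H} (hA : IsControlled 𝒴 A) : IsApprox 𝒴 A :=
  subset_closure hA

theorem IsApprox.comp {B : E'.H →L[ℂ] E''.H} {A : E.H →L[ℂ] E'.H}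
    (hB : IsApprox 𝒴 B) (hA : IsApprox 𝒴 A) : IsApprox 𝒴 (B ∘L A) := by
  refine mem_closure_of_continuous (f := fun B : E'.H →L[ℂ] E''.H => B ∘L A) (by fun_prop)
    (fun B' hB' => ?_) hB
  exact mem_closure_of_continuous (f := fun A : E.H →L[ℂ] E'.H => B' ∘L A) (by fun_prop)
    (fun A' hA' => subset_closure (IsControlled.comp hB' hA')) hA

theorem IsApprox.adjoint {A : E.H →L[ℂ] E'.H} (hA : IsApprox 𝒴 A) : IsApprox 𝒴 A.adjoint :=
  mem_closure_of_continuous (ContinuousLinearMap.adjoint (𝕜 := ℂ) (E := E.H) (F := E'.H)).continuous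
    (fun _ hA' => subset_closure (IsControlled.adjoint hA')) hA

end ControlledHilbert

/-! ### Classes of projections and Murray–von Neumann equivalence -/

open ControlledHilbert

/-- The zero projection on the same object. -/
def KGen.zeroOn (a : KGen 𝒴) : KGen 𝒴 where
  obj := a.obj
  locFin := a.locFin
  det := a.det
  q := 0
  approx := (isControlled_zero 𝒴 _ _).isApprox
  isProj := ⟨by simp [IsIdempotentElem], by simp⟩

namespace KX0

theorem mk_add_mk {a b c : KGen 𝒴} (h : KGen.OrthSum a b c) : mk a + mk b = mk c := by
  unfold mk
  rw [← QuotientAddGroup.mk_add, ← sub_eq_zero, ← QuotientAddGroup.mk_sub]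
  exact (QuotientAddGroup.eq_zero_iff _).2 (AddSubgroup.subset_closure ⟨a, b, c, h, rfl⟩)

theorem mk_zeroOn (a : KGen 𝒴) : mk a.zeroOn = 0 := by
  have : KGen.OrthSum a.zeroOn a.zeroOn a.zeroOn :=
    ⟨0, 0, a.zeroOn.approx, a.zeroOn.approx, comp_zero _, comp_zero _, comp_zero _, by
      rw [zero_comp, add_zero]; rfl⟩
  simpa using mk_add_mk this

/-- Murray-von Neumann equivalent projections have the same class. -/
theorem mk_eq_mk {a b : KGen 𝒴} (v : a.obj.H →L[ℂ] b.obj.H) (hv : IsApprox 𝒴 v)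
    (h1 : v.adjoint ∘L v = a.q) (h2 : v ∘L v.adjoint = b.q) : mk a = mk b := by
  -- An equivalence of `a` with `b` exhibits `b` as the orthogonal sum of `a` and a zero projection,
  -- whose class vanishes.
  have : KGen.OrthSum a a.zeroOn b :=
    ⟨v, 0, hv, (isControlled_zero 𝒴 a.obj b.obj).isApprox, h1, comp_zero _,
      comp_zero _, by rw [zero_comp, add_zero, h2]⟩
  simpa [mk_zeroOn] using mk_add_mk this

/-- If `v* v` is a projection, then `v v* v = v`. -/
theorem _root_.ContinuousLinearMap.comp_adjoint_comp_self {H K : Type*} [NormedAddCommGroup H]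
    [InnerProductSpace ℂ H] [CompleteSpace H] [NormedAddCommGroup K] [InnerProductSpace ℂ K]
    [CompleteSpace K] {v : H →L[ℂ] K} {q : H →L[ℂ] H} (hq : IsStarProjection q)
    (h : v.adjoint ∘L v = q) : v ∘L q = v := by
  have h1 : q ∘L q = q := hq.isIdempotentElem
  have h2 : q.adjoint = q := hq.isSelfAdjoint
  -- The four terms of the product are all equal to `q` up to sign and cancel; an operator `B` with
  -- `B* B = 0` is zero.
  have h3 : (v ∘L q - v).adjoint ∘L (v ∘L q - v) = 0 := by
    rw [map_sub, adjoint_comp, h2, sub_comp, comp_sub, comp_sub]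
    have e1 : (q ∘L v.adjoint) ∘L v ∘L q = q := by
      rw [comp_assoc, ← comp_assoc (v.adjoint), h, h1, h1]
    have e2 : (q ∘L v.adjoint) ∘L v = q := by rw [comp_assoc, h, h1]
    have e3 : v.adjoint ∘L v ∘L q = q := by rw [← comp_assoc, h, h1]
    rw [e1, e2, e3, h]; simp
  have h4 : v ∘L q - v = 0 := by
    ext x
    have := congrArg (fun A : H →L[ℂ] H => ⟪A x, x⟫_ℂ) h3
    simp only [comp_apply, adjoint_inner_left, zero_apply, inner_zero_left] at this
    exact inner_self_eq_zero.1 this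
  exact sub_eq_zero.1 h4

/-- Both representatives are equivalent to `P`, by `v` and `w`, so `w* v` is an equivalence between
them. -/
theorem IsClassOf.unique {P : E.H →L[ℂ] E.H} {c c' : KX0 𝒴} (h : IsClassOf P c)
    (h' : IsClassOf P c') : c = c' := by
  obtain ⟨a, v, hv, h1, h2, rfl⟩ := h
  obtain ⟨b, w, hw, h3, h4, rfl⟩ := h'
  have e1 := comp_adjoint_comp_self a.isProj h1
  have e2 := comp_adjoint_comp_self b.isProj h3
  have e3 : P ∘L v = v := by rw [← h2, comp_assoc, h1, e1]
  have e4 : P ∘L w = w := by rw [← h4, comp_assoc, h3, e2]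
  refine mk_eq_mk (w.adjoint ∘L v) (hw.adjoint.comp hv) ?_ ?_
  · rw [adjoint_comp, adjoint_adjoint, comp_assoc, ← comp_assoc w, h4, e3, h1]
  · rw [adjoint_comp, adjoint_adjoint, comp_assoc, ← comp_assoc v, h2, e4, h3]

theorem IsClassOf.transport {P : E.H →L[ℂ] E.H} {P' : E'.H →L[ℂ] E'.H} {c : KX0 𝒴}
    (h : IsClassOf P c) (t : E.H →L[ℂ] E'.H) (ht : IsApprox 𝒴 t) (h1 : t.adjoint ∘L t = P)
    (h2 : t ∘L t.adjoint = P') (htP : t ∘L P = t) : IsClassOf P' c := by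
  obtain ⟨a, v, hv, h3, h4, rfl⟩ := h
  have e1 := comp_adjoint_comp_self a.isProj h3
  have e3 : P ∘L v = v := by rw [← h4, comp_assoc, h3, e1]
  refine ⟨a, t ∘L v, ht.comp hv, ?_, ?_, rfl⟩
  · rw [adjoint_comp, comp_assoc, ← comp_assoc _ t, h1, e3, h3]
  · rw [adjoint_comp, comp_assoc, ← comp_assoc v, h4, ← comp_assoc, htP, h2]

theorem IsClassOf.push {𝒴' : BornCoarse Y'} {f : Y → Y'} (hf : 𝒴.IsMorphism 𝒴' f)
    {P : E.H →L[ℂ] E.H} {c : KX0 𝒴} (h : IsClassOf P c) :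
    IsClassOf (E := E.push f) P (map hf c) := by
  obtain ⟨a, v, hv, h1, h2, rfl⟩ := h
  refine ⟨a.push hf, v, hv.push hf, h1, h2, ?_⟩
  simp [map, mk]

end KX0

/-! ### Restriction to subspaces invariant under the projection-valued measure -/

namespace ControlledHilbert

/-- The restriction of a controlled Hilbert space to an invariant complete subspace. -/
def restrict (E : ControlledHilbert Y) (K : Submodule ℂ E.H) [CompleteSpace K]
    (hK : ∀ S, ∀ x ∈ K, E.μ S x ∈ K) : ControlledHilbert Y where
  H := K
  μ S := ((E.μ S).comp K.subtypeL).codRestrict K fun x => hK S x x.2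
  proj S :=
    { isIdempotentElem := by
        ext x
        exact congrArg (fun A : E.H →L[ℂ] E.H => A x) (E.proj S).isIdempotentElem
      isSelfAdjoint := by
        rw [ContinuousLinearMap.isSelfAdjoint_iff_isSymmetric]
        intro x y
        exact (ContinuousLinearMap.isSelfAdjoint_iff_isSymmetric.1 (E.proj S).isSelfAdjoint) x y }
  μ_univ := by ext x; exact congrArg (fun A : E.H →L[ℂ] E.H => A x) E.μ_univ
  μ_inter S T := by ext x; exact congrArg (fun A : E.H →L[ℂ] E.H => A x) (E.μ_inter S T)
  μ_union S T h := by ext x; exact congrArg (fun A : E.H →L[ℂ] E.H => A x) (E.μ_union S T h)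

variable (E) (K : Submodule ℂ E.H) [CompleteSpace K] (hK : ∀ S, ∀ x ∈ K, E.μ S x ∈ K)

/-- The inclusion of the restriction. -/
def incl : (E.restrict K hK).H →ₗᵢ[ℂ] E.H := K.subtypeₗᵢ

/-- The inclusion intertwines the two measures, so an entourage which controls the identity of `E`
controls it as well. -/
theorem isControlled_incl :
    IsControlled 𝒴 (E := E.restrict K hK) (E.incl K hK).toContinuousLinearMap := by
  obtain ⟨U, hU, h⟩ := isControlled_id 𝒴 E
  refine ⟨U, hU, fun S T hST => ?_⟩
  ext x
  exact congrArg (fun A : E.H →L[ℂ] E.H => A (E.incl K hK x)) (h S T hST)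

theorem adjoint_incl_comp_incl :
    ContinuousLinearMap.adjoint (E.incl K hK).toContinuousLinearMap ∘L
      (E.incl K hK).toContinuousLinearMap = ContinuousLinearMap.id ℂ (E.restrict K hK).H :=
  (ContinuousLinearMap.norm_map_iff_adjoint_comp_self _).1 (E.incl K hK).norm_map

theorem incl_comp_adjoint_incl_apply {x : E.H} (hx : x ∈ K) :
    E.incl K hK (ContinuousLinearMap.adjoint (E.incl K hK).toContinuousLinearMap x) = x := by
  have := congrArg (fun A => E.incl K hK (A ⟨x, hx⟩)) (E.adjoint_incl_comp_incl K hK)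
  exact this

/-- A vector `x` orthogonal to all point subspaces satisfies `‖μ{y} x‖² = ⟪μ{y} x, x⟫ = 0` for every
`y`, so the hypothesis forces the orthogonal complement of their span to vanish. -/
theorem isDeterminedOnPoints_restrict
    (h : ∀ x ∈ K, (∀ y, E.μ {y} x = 0) → x = 0) : (E.restrict K hK).IsDeterminedOnPoints := by
  rw [IsDeterminedOnPoints, Submodule.topologicalClosure_eq_top_iff, Submodule.eq_bot_iff]
  intro x hx
  refine Subtype.ext (h (E.incl K hK x) (Subtype.property (p := (· ∈ K)) x) fun y => ?_)
  have h1 : ⟪(E.restrict K hK).μ {y} x, x⟫_ℂ = 0 :=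
    hx _ (Submodule.mem_iSup_of_mem y ⟨x, rfl⟩)
  have h2 : (E.restrict K hK).μ {y} x = 0 := by
    have h3 : (E.restrict K hK).μ {y} ((E.restrict K hK).μ {y} x) = (E.restrict K hK).μ {y} x :=
      congrArg (fun A : (E.restrict K hK).H →L[ℂ] (E.restrict K hK).H => A x)
        ((E.restrict K hK).proj {y}).isIdempotentElem
    rw [← h3, ← (E.restrict K hK).adjoint_μ, adjoint_inner_left, adjoint_μ] at h1
    exact inner_self_eq_zero.1 h1
  exact congrArg Subtype.val h2

end ControlledHilbert

end

noncomputable section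

/-! ## Averages of isometries -/

section Averages

variable {H : Type*} [NormedAddCommGroup H] [InnerProductSpace ℂ H] {α : Type*}

/-- The average of the operators `(1 + V s) / 2`, `s ∈ S`. -/
def lazyAverage (S : Finset α) (V : α → H →ₗᵢ[ℂ] H) : H →L[ℂ] H :=
  (2 * S.card : ℂ)⁻¹ • ∑ s ∈ S, (ContinuousLinearMap.id ℂ H + (V s).toContinuousLinearMap)

theorem lazyAverage_apply (S : Finset α) (V : α → H →ₗᵢ[ℂ] H) (x : H) :
    lazyAverage S V x = (2 * S.card : ℂ)⁻¹ • ∑ s ∈ S, (x + V s x) := by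
  simp [lazyAverage]

/-- Used with `A` the identity, to see that fixed vectors stay fixed, and with `A` the projection,
to see that averaging does not change the projected component. -/
theorem map_lazyAverage_of_fixed {S : Finset α} (hS : S.Nonempty) {V : α → H →ₗᵢ[ℂ] H} {x : H}
    {A : H →L[ℂ] H} (h : ∀ s ∈ S, A (V s x) = A x) : A (lazyAverage S V x) = A x := by
  have hc : (2 * S.card : ℂ) ≠ 0 :=
    mul_ne_zero two_ne_zero (Nat.cast_ne_zero.2 hS.card_pos.ne')
  rw [lazyAverage_apply, map_smul, map_sum, Finset.sum_congr rfl fun s hs => by rw [map_add, h s hs],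
    Finset.sum_const, ← two_smul ℂ (A x), ← Nat.cast_smul_eq_nsmul ℂ, smul_smul, smul_smul, mul_assoc,
    mul_comm (S.card : ℂ), inv_mul_cancel₀ hc, one_smul]

/-- By the parallelogram law `‖x + y‖² = 4 ‖x‖² - ‖x - y‖²`. -/
theorem norm_add_le_of_le_norm_sub {κ : ℝ} (h0 : 0 < κ) (h1 : κ < 1) {x y : H} (hxy : ‖y‖ = ‖x‖)
    (h : κ * ‖x‖ ≤ ‖x - y‖) : ‖x + y‖ ≤ √(4 - κ ^ 2) * ‖x‖ := by
  have hp := parallelogram_law_with_norm ℂ x y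
  have hs : √(4 - κ ^ 2) ^ 2 = 4 - κ ^ 2 := Real.sq_sqrt (by nlinarith)
  refine le_of_sq_le_sq ?_ (by positivity)
  have h2 : (κ * ‖x‖) ^ 2 ≤ ‖x - y‖ ^ 2 := pow_le_pow_left₀ (by positivity) h 2
  rw [hxy] at hp
  rw [mul_pow, hs]
  nlinarith

/-- The norm of a lazy average on a vector which is moved by some isometry in the family. -/
theorem exists_norm_lazyAverage_le (S : Finset α) {κ : ℝ} (h0 : 0 < κ) (h1 : κ < 1) :
    ∃ c : ℝ, 0 ≤ c ∧ c < 1 ∧ ∀ {H : Type u} [NormedAddCommGroup H] [InnerProductSpace ℂ H]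
      (V : α → H →ₗᵢ[ℂ] H) (x : H), (∃ s ∈ S, κ * ‖x‖ ≤ ‖x - V s x‖) →
        ‖lazyAverage S V x‖ ≤ c * ‖x‖ := by
  rcases S.eq_empty_or_nonempty with rfl | hS
  · exact ⟨0, le_rfl, one_pos, fun V x ⟨s, hs, _⟩ => absurd hs (Finset.notMem_empty s)⟩
  have hm : (1 : ℝ) ≤ S.card := by exact_mod_cast hS.card_pos
  have hs : √(4 - κ ^ 2) < 2 := by
    rw [Real.sqrt_lt' two_pos]; nlinarith
  -- With `m` the cardinality of `S`, one summand `x + V s x` has norm at most `√(4 - κ²) ‖x‖` and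
  -- each of the other `m - 1` at most `2 ‖x‖`; the sum is divided by `2m`. The result is less than
  -- `1` because `√(4 - κ²) < 2`.
  refine ⟨(2 * (S.card : ℝ))⁻¹ * (2 * ((S.card : ℝ) - 1) + √(4 - κ ^ 2)), ?_, ?_, ?_⟩
  · have := Real.sqrt_nonneg (4 - κ ^ 2)
    have : 0 ≤ 2 * ((S.card : ℝ) - 1) := by linarith
    positivity
  · rw [inv_mul_lt_iff₀ (by positivity)]
    linarith
  · rintro H _ _ V x ⟨s, hsS, hx⟩
    classical
    rw [lazyAverage_apply, norm_smul, norm_inv, norm_mul, Complex.norm_ofNat, Complex.norm_natCast,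
      mul_assoc]
    refine mul_le_mul_of_nonneg_left ?_ (by positivity)
    rw [← Finset.add_sum_erase _ _ hsS]
    have e1 := norm_add_le_of_le_norm_sub h0 h1 ((V s).norm_map x) hx
    have e2 : ‖∑ t ∈ S.erase s, (x + V t x)‖ ≤ (S.erase s).card • (2 * ‖x‖) := by
      refine Finset.sum_const (2 * ‖x‖) ▸ norm_sum_le_of_le _ fun t _ => ?_
      refine (norm_add_le _ _).trans ?_
      rw [(V t).norm_map]; linarith
    rw [Finset.card_erase_of_mem hsS, nsmul_eq_mul, Nat.cast_sub hS.card_pos, Nat.cast_one] at e2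
    refine (norm_add_le _ _).trans ?_
    linarith

/-- Since the right inverse `W` also preserves `K`, the isometry `V` preserves the orthogonal
complement of `K` too. -/
theorem starProjection_comp_isometry {K : Submodule ℂ H} [K.HasOrthogonalProjection]
    {V W : H →ₗᵢ[ℂ] H} (hVW : ∀ x, V (W x) = x) (hV : ∀ x ∈ K, V x ∈ K) (hW : ∀ x ∈ K, W x ∈ K)
    (x : H) : K.starProjection (V x) = V (K.starProjection x) := by
  refine Submodule.eq_starProjection_of_mem_of_inner_eq_zero
    (hV _ (K.starProjection_apply_mem x)) fun w hw => ?_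
  rw [← map_sub, ← hVW w, V.inner_map_map]
  exact K.starProjection_inner_eq_zero _ _ (hW w hw)

/-- If `T` fixes the range of a projection `P`, commutes with it, and is a strict contraction on the
complement, then the powers of `T` converge to `P`. -/
theorem tendsto_pow_starProjection {K : Submodule ℂ H} [K.HasOrthogonalProjection]
    {T : H →L[ℂ] H} {c : ℝ} (hc0 : 0 ≤ c) (hc : c < 1) (h1 : ∀ x ∈ K, T x = x)
    (h2 : ∀ x, K.starProjection (T x) = K.starProjection x) (h3 : ∀ x ∈ Kᗮ, ‖T x‖ ≤ c * ‖x‖) :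
    Tendsto (fun k : ℕ => T ^ k) atTop (𝓝 K.starProjection) := by
  -- The complement is `T`-invariant because, by `h2`, `T` does not change the component in `K`;
  -- hence the contraction can be iterated.
  have hK : ∀ (k : ℕ), ∀ x ∈ Kᗮ, (T ^ k) x ∈ Kᗮ ∧ ‖(T ^ k) x‖ ≤ c ^ k * ‖x‖ := by
    intro k
    induction k with
    | zero => intro x hx; simpa using hx
    | succ k ih =>
      intro x hx
      obtain ⟨i1, i2⟩ := ih x hx
      have e : (T ^ (k + 1)) x = T ((T ^ k) x) := by rw [pow_succ']; rfl
      rw [e]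
      constructor
      · rw [← K.starProjection_apply_eq_zero_iff] at i1 ⊢
        rw [h2, i1]
      · refine (h3 _ i1).trans ?_
        rw [pow_succ', mul_assoc]
        exact mul_le_mul_of_nonneg_left i2 hc0
  have hfix : ∀ (k : ℕ), ∀ x ∈ K, (T ^ k) x = x := by
    intro k
    induction k with
    | zero => intro x hx; rfl
    | succ k ih =>
      intro x hx
      have e : (T ^ (k + 1)) x = T ((T ^ k) x) := by rw [pow_succ']; rfl
      rw [e, ih x hx, h1 x hx]
  rw [tendsto_iff_norm_sub_tendsto_zero]
  refine squeeze_zero (fun _ => norm_nonneg _) (fun k => ?_) (tendsto_pow_atTop_nhds_zero_of_lt_one hc0 hc)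
  refine ContinuousLinearMap.opNorm_le_bound _ (by positivity) fun x => ?_
  have e : (T ^ k - K.starProjection) x = (T ^ k) (x - K.starProjection x) := by
    rw [map_sub, hfix k _ (K.starProjection_apply_mem x)]; rfl
  rw [e]
  refine (hK k _ (K.sub_starProjection_mem_orthogonal x)).2.trans ?_
  refine mul_le_mul_of_nonneg_left ?_ (by positivity)
  rw [← K.starProjection_orthogonal_val]
  exact Kᗮ.norm_starProjection_apply_le x

end Averages

/-! ## The measure on `ℤ × X` and its slices -/

section Slices

variable {X : Type u} [MeasurableSpace X] (ν : Measure X)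

/-- The counting measure is a sum of Dirac measures. This reduces almost-everywhere statements and
integrals on `ℤ × X` to the slices. -/
theorem nuHat_eq_sum [SFinite ν] : nuHat ν = Measure.sum fun n : ℤ => ν.map (Prod.mk n) := by
  rw [nuHat, Measure.count, Measure.prod_sum_left]
  simp only [Measure.dirac_prod]

variable {ν}

theorem ae_nuHat_iff [SFinite ν] {p : ℤ × X → Prop} :
    (∀ᵐ q ∂(nuHat ν), p q) ↔ ∀ n, ∀ᵐ x ∂ν, p (n, x) := by
  rw [nuHat_eq_sum, Measure.ae_sum_iff]
  exact forall_congr' fun n => (measurableEmbedding_prodMk_left n).ae_map_iff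

theorem lintegral_nuHat [SFinite ν] (f : ℤ × X → ENNReal) :
    ∫⁻ p, f p ∂(nuHat ν) = ∑' n, ∫⁻ x, f (n, x) ∂ν := by
  rw [nuHat_eq_sum, lintegral_sum_measure]
  exact tsum_congr fun n => (measurableEmbedding_prodMk_left n).lintegral_map _

theorem component_meas (n : ℤ) : MeasurableSet (component X n) :=
  measurable_fst (measurableSet_singleton n)

variable (ν) in
theorem nuHat_restrict_component [SFinite ν] (n : ℤ) :
    (nuHat ν).restrict (component X n) = ν.map (Prod.mk n) := by
  have : component X n = {n} ×ˢ univ := by ext p; simp [component]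
  rw [this, ← Measure.prod_restrict, Measure.restrict_univ, Measure.restrict_singleton,
    Measure.count_singleton, one_smul, Measure.dirac_prod]

theorem nuHat_component [IsProbabilityMeasure ν] (n : ℤ) : nuHat ν (component X n) = 1 := by
  rw [← Measure.restrict_apply_univ, nuHat_restrict_component,
    (measurableEmbedding_prodMk_left n).map_apply]
  simp

theorem memLp_slice [SFinite ν] (f : Lp ℂ 2 (nuHat ν)) (n : ℤ) :
    MemLp (fun x => f (n, x)) 2 ν := by
  have h := (Lp.memLp f).restrict (component X n)
  rw [nuHat_restrict_component] at h
  exact ((measurableEmbedding_prodMk_left n).memLp_map_measure_iff).1 h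

variable (ν) in
/-- The restriction of a function on `ℤ × X` to `{n} × X`. -/
def slice [SFinite ν] (n : ℤ) : Lp ℂ 2 (nuHat ν) →ₗ[ℂ] Lp ℂ 2 ν where
  toFun f := (memLp_slice f n).toLp _
  map_add' f g := by
    refine Lp.ext ?_
    filter_upwards [(memLp_slice (f + g) n).coeFn_toLp, (memLp_slice f n).coeFn_toLp,
      (memLp_slice g n).coeFn_toLp, Lp.coeFn_add ((memLp_slice f n).toLp _)
        ((memLp_slice g n).toLp _), ae_nuHat_iff.1 (Lp.coeFn_add f g) n] with x h1 h2 h3 h4 h5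
    rw [h1, h4, Pi.add_apply, h2, h3, h5, Pi.add_apply]
  map_smul' c f := by
    refine Lp.ext ?_
    filter_upwards [(memLp_slice (c • f) n).coeFn_toLp, (memLp_slice f n).coeFn_toLp,
      Lp.coeFn_smul c ((memLp_slice f n).toLp _), ae_nuHat_iff.1 (Lp.coeFn_smul c f) n]
      with x h1 h2 h3 h4
    rw [h1, RingHom.id_apply, h3, Pi.smul_apply, h2, h4, Pi.smul_apply]

theorem slice_coe [SFinite ν] (n : ℤ) (f : Lp ℂ 2 (nuHat ν)) :
    slice ν n f =ᵐ[ν] fun x => f (n, x) :=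
  (memLp_slice f n).coeFn_toLp

theorem enorm_sq_eq_lintegral {Ω : Type*} [MeasurableSpace Ω] {m : Measure Ω} (f : Lp ℂ 2 m) :
    ‖f‖ₑ ^ 2 = ∫⁻ x, ‖f x‖ₑ ^ 2 ∂m := by
  have := eLpNorm_nnreal_pow_eq_lintegral (μ := m) (f := f) (p := 2) two_ne_zero
  rw [Lp.enorm_def]
  simpa using this

theorem enorm_sq_eq_tsum_slice [SFinite ν] (f : Lp ℂ 2 (nuHat ν)) :
    ‖f‖ₑ ^ 2 = ∑' n, ‖slice ν n f‖ₑ ^ 2 := by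
  rw [enorm_sq_eq_lintegral, lintegral_nuHat]
  refine tsum_congr fun n => ?_
  rw [enorm_sq_eq_lintegral]
  refine lintegral_congr_ae ?_
  filter_upwards [slice_coe n f] with x hx
  rw [hx]

/-- The square of the norm is the sum of those of the slices. The comparison is made in `ENNReal`,
where no summability has to be checked. -/
theorem norm_le_of_norm_slice_le [SFinite ν] {f g : Lp ℂ 2 (nuHat ν)} {c : ℝ} (hc : 0 ≤ c)
    (h : ∀ n, ‖slice ν n f‖ ≤ c * ‖slice ν n g‖) : ‖f‖ ≤ c * ‖g‖ := by
  have key : ‖f‖ₑ ^ 2 ≤ (ENNReal.ofReal c * ‖g‖ₑ) ^ 2 := by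
    rw [mul_pow, enorm_sq_eq_tsum_slice, enorm_sq_eq_tsum_slice, ← ENNReal.tsum_mul_left]
    refine ENNReal.tsum_le_tsum fun n => ?_
    rw [← mul_pow]
    refine pow_le_pow_left₀ zero_le ?_ 2
    rw [← ofReal_norm, ← ofReal_norm, ← ENNReal.ofReal_mul hc]
    exact ENNReal.ofReal_le_ofReal (h n)
  have key2 := (ENNReal.pow_le_pow_left_iff two_ne_zero).1 key
  rw [← ofReal_norm, ← ofReal_norm, ← ENNReal.ofReal_mul hc] at key2
  exact (ENNReal.ofReal_le_ofReal_iff (by positivity)).1 key2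

theorem indicator_component_mem_fibrewiseConst (n : ℤ) (h : nuHat ν (component X n) ≠ ⊤) :
    indicatorConstLp 2 (component_meas n) h (1 : ℂ) ∈ fibrewiseConst ν := by
  refine ⟨({n} : Set ℤ).indicator 1, ?_⟩
  filter_upwards [indicatorConstLp_coeFn (hs := component_meas n) (hμs := h) (c := (1 : ℂ))]
    with p hp
  rw [hp]
  by_cases h : p.1 = n <;> simp [component, h]

end Slices

/-! ## Composition with measure preserving maps -/

section Pullback

variable {X : Type u} [MeasurableSpace X] {ν : Measure X}

theorem pullback_coe {φ : ℤ × X → ℤ × X} (hφ : MeasurePreserving φ (nuHat ν) (nuHat ν))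
    (f : Lp ℂ 2 (nuHat ν)) : Lp.compMeasurePreservingₗᵢ ℂ φ hφ f =ᵐ[nuHat ν] f ∘ φ :=
  Lp.coeFn_compMeasurePreserving f hφ

theorem pullback_mem_fibrewiseConst {φ : ℤ × X → ℤ × X}
    (hφ : MeasurePreserving φ (nuHat ν) (nuHat ν)) {e : ℤ → ℤ} (he : ∀ p, (φ p).1 = e p.1)
    {f : Lp ℂ 2 (nuHat ν)} (hf : f ∈ fibrewiseConst ν) :
    Lp.compMeasurePreservingₗᵢ ℂ φ hφ f ∈ fibrewiseConst ν := by
  obtain ⟨c, hc⟩ := hf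
  refine ⟨c ∘ e, ?_⟩
  filter_upwards [pullback_coe hφ f, hφ.quasiMeasurePreserving.ae hc] with p h1 h2
  rw [h1, Function.comp_apply, h2, he, Function.comp_apply]

theorem pullback_eq_self {φ : ℤ × X → ℤ × X}
    (hφ : MeasurePreserving φ (nuHat ν) (nuHat ν)) (he : ∀ p, (φ p).1 = p.1)
    {f : Lp ℂ 2 (nuHat ν)} (hf : f ∈ fibrewiseConst ν) :
    Lp.compMeasurePreservingₗᵢ ℂ φ hφ f = f := by
  obtain ⟨c, hc⟩ := hf
  refine Lp.ext ?_
  filter_upwards [pullback_coe hφ f, hφ.quasiMeasurePreserving.ae hc, hc] with p h1 h2 h3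
  rw [h1, Function.comp_apply, h2, he, h3]

theorem pullback_pullback {φ ψ : ℤ × X → ℤ × X} (hφ : MeasurePreserving φ (nuHat ν) (nuHat ν))
    (hψ : MeasurePreserving ψ (nuHat ν) (nuHat ν)) (h : ∀ p, ψ (φ p) = p) (f : Lp ℂ 2 (nuHat ν)) :
    Lp.compMeasurePreservingₗᵢ ℂ φ hφ (Lp.compMeasurePreservingₗᵢ ℂ ψ hψ f) = f := by
  refine Lp.ext ?_
  filter_upwards [pullback_coe hφ (Lp.compMeasurePreservingₗᵢ ℂ ψ hψ f),
    hφ.quasiMeasurePreserving.ae (pullback_coe hψ f)] with p h1 h2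
  rw [h1, Function.comp_apply, h2, Function.comp_apply, h]

theorem measurePreserving_shift [SFinite ν] (k : ℤ) :
    MeasurePreserving (shift X k) (nuHat ν) (nuHat ν) :=
  (measurePreserving_add_right (Measure.count : Measure ℤ) k).prod (MeasurePreserving.id ν)

variable {G : Type v} [Group G] [MulAction G X] [MeasurableConstSMul G X]
  [SMulInvariantMeasure G X ν]

variable (ν) in
theorem measurePreserving_sqAct [SFinite ν] (g : G) :
    MeasurePreserving (sqAct G X g) (nuHat ν) (nuHat ν) :=
  (MeasurePreserving.id (Measure.count : Measure ℤ)).prod (measurePreserving_smul g ν)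

variable (ν) in
/-- The unitary representation of `G` on `L²(ℤ × X)`. -/
def rhoHat [SFinite ν] (g : G) : Lp ℂ 2 (nuHat ν) →ₗᵢ[ℂ] Lp ℂ 2 (nuHat ν) :=
  Lp.compMeasurePreservingₗᵢ ℂ (sqAct G X g⁻¹) (measurePreserving_sqAct ν g⁻¹)

theorem slice_rhoHat [SFinite ν] (g : G) (n : ℤ) (f : Lp ℂ 2 (nuHat ν)) :
    slice ν n (rhoHat ν g f) = rho ν g (slice ν n f) := by
  refine Lp.ext ?_
  filter_upwards [slice_coe n (rhoHat ν g f),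
    ae_nuHat_iff.1 (pullback_coe (measurePreserving_sqAct ν g⁻¹) f) n,
    Lp.coeFn_compMeasurePreserving (slice ν n f) (measurePreserving_smul g⁻¹ ν),
    (measurePreserving_smul g⁻¹ ν).quasiMeasurePreserving.ae (slice_coe n f)] with x h1 h2 h3 h4
  rw [h1]
  refine h2.trans (Eq.trans ?_ h3.symm)
  exact h4.symm

theorem slice_lazyAverage [SFinite ν] (S : Finset G) (n : ℤ) (f : Lp ℂ 2 (nuHat ν)) :
    slice ν n (lazyAverage S (rhoHat ν) f) = lazyAverage S (rho ν) (slice ν n f) := by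
  simp only [lazyAverage_apply, map_smul, map_sum, map_add, slice_rhoHat]

theorem rhoHat_eq_self [SFinite ν] (g : G) {f : Lp ℂ 2 (nuHat ν)} (hf : f ∈ fibrewiseConst ν) :
    rhoHat ν g f = f :=
  pullback_eq_self (measurePreserving_sqAct ν g⁻¹) (fun _ => rfl) hf

theorem rhoHat_rhoHat_inv [SFinite ν] (g : G) (f : Lp ℂ 2 (nuHat ν)) :
    rhoHat ν g (rhoHat ν g⁻¹ f) = f := by
  refine pullback_pullback (measurePreserving_sqAct ν g⁻¹) (measurePreserving_sqAct ν g⁻¹⁻¹)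
    (fun p => ?_) f
  rw [← Equiv.Perm.mul_apply, ← map_mul, inv_inv, mul_inv_cancel, map_one]
  rfl

/-- The projection commutes with `rhoHat ν g`, which is the identity on its range. -/
theorem starProjection_rhoHat [SFinite ν] (g : G) (f : Lp ℂ 2 (nuHat ν)) :
    (fibrewiseConst ν).starProjection (rhoHat ν g f) = (fibrewiseConst ν).starProjection f := by
  rw [starProjection_comp_isometry (V := rhoHat ν g) (rhoHat_rhoHat_inv g)
    (fun x hx => by rwa [rhoHat_eq_self g hx]) (fun x hx => by rwa [rhoHat_eq_self g⁻¹ hx])]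
  exact rhoHat_eq_self g (Submodule.starProjection_apply_mem _ _)

/-- Preimages of measurable sets under `f` are invariant up to null sets, so by ergodicity they are
null or conull; a function with this property into `ℂ` is almost everywhere constant. -/
theorem exists_ae_eq_const_of_mem_invariants {ν : Measure X} [ErgodicSMul G X ν] {f : Lp ℂ 2 ν}
    (hf : f ∈ invariants G ν) : ∃ c : ℂ, f =ᵐ[ν] Function.const X c := by
  refine exists_eventuallyEq_const_of_forall_separating MeasurableSet fun U hU => ?_
  have hm : NullMeasurableSet (f ⁻¹' U) ν :=
    ((Lp.stronglyMeasurable f).measurable hU).nullMeasurableSet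
  have hinv : ∀ g : G, f ∘ (g • ·) =ᵐ[ν] f := fun g => by
    have h1 : rho ν g⁻¹ f = f := by
      simpa [LinearMap.mem_eqLocus] using (Submodule.mem_iInf _).1 hf g⁻¹
    have h2 := Lp.coeFn_compMeasurePreserving f (measurePreserving_smul g⁻¹⁻¹ ν)
    have h3 : (rho ν g⁻¹ f : X → ℂ) =ᵐ[ν] f ∘ (g⁻¹⁻¹ • ·) := h2
    rw [h1, inv_inv] at h3
    exact h3.symm
  have := aeconst_of_forall_preimage_smul_ae_eq G hm fun g => by
    refine (hinv g).mono fun x hx => ?_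
    exact congrArg (· ∈ U) hx
  exact eventuallyConst_set.1 this

/-- Pairing `f` with the characteristic function of `{n} × X` shows that its `n`-th slice has
integral zero, and the invariants are constants. -/
theorem slice_mem_invariants_orthogonal {ν : Measure X} [IsProbabilityMeasure ν] [ErgodicSMul G X ν]
    {f : Lp ℂ 2 (nuHat ν)} (hf : f ∈ (fibrewiseConst ν)ᗮ) (n : ℤ) :
    slice ν n f ∈ (invariants G ν)ᗮ := by
  have hfin : nuHat ν (component X n) ≠ ⊤ := by simp [nuHat_component]
  have h1 := indicator_component_mem_fibrewiseConst n hfin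
  have h2 := hf _ h1
  rw [L2.inner_indicatorConstLp_one, nuHat_restrict_component,
    (measurableEmbedding_prodMk_left n).integral_map] at h2
  intro g hg
  obtain ⟨c, hc⟩ := exists_ae_eq_const_of_mem_invariants hg
  rw [L2.inner_def]
  have : ∫ x, ⟪g x, slice ν n f x⟫_ℂ ∂ν = ∫ x, ⟪c, f (n, x)⟫_ℂ ∂ν := by
    refine integral_congr_ae ?_
    filter_upwards [hc, slice_coe n f] with x h1 h2
    rw [h1, h2]; rfl
  rw [this]
  simp only [RCLike.inner_apply]
  rw [integral_mul_const, h2, zero_mul]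

/-- If the action has a spectral gap, then the Drutu-Nowak projection is the limit of the powers of
an average of operators in the image of the group. -/
theorem exists_tendsto_drutuNowak {ν : Measure X} [IsProbabilityMeasure ν] [ErgodicSMul G X ν]
    (hgap : HasSpectralGap G ν) : ∃ S : Finset G,
      Tendsto (fun k : ℕ => lazyAverage S (rhoHat ν) ^ k) atTop (𝓝 (drutuNowak ν)) := by
  obtain ⟨S, κ, h0, h1, hS⟩ := hgap
  obtain ⟨c, hc0, hc1, hc⟩ := exists_norm_lazyAverage_le S h0 h1
  -- The gap condition at the zero vector already provides an element of `S`.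
  have hne : S.Nonempty := by
    obtain ⟨s, hs, -⟩ := hS 0 (Submodule.zero_mem _)
    exact ⟨s, hs⟩
  refine ⟨S, tendsto_pow_starProjection hc0 hc1 (fun f hf => ?_) (fun f => ?_) fun f hf => ?_⟩
  · exact map_lazyAverage_of_fixed (A := ContinuousLinearMap.id ℂ _) hne fun g _ =>
      rhoHat_eq_self g hf
  · exact map_lazyAverage_of_fixed hne fun g _ => starProjection_rhoHat g f
  · refine norm_le_of_norm_slice_le hc0 fun n => ?_
    rw [slice_lazyAverage]
    exact hc _ _ (hS _ (slice_mem_invariants_orthogonal hf n))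

end Pullback

end

noncomputable section

open ControlledHilbert ContinuousLinearMap

/-! ## Projections onto subspaces of locally finite subspaces -/

section Corner

variable {Y : Type u} {𝒴 : BornCoarse Y} {E : ControlledHilbert Y} {K : Submodule ℂ E.H}
  [CompleteSpace K] (hK : ∀ S, ∀ x ∈ K, E.μ S x ∈ K) {P : E.H →L[ℂ] E.H}

namespace ControlledHilbert

theorem incl_adjoint_comp (hP : ∀ x, P x ∈ K) :
    (E.incl K hK).toContinuousLinearMap ∘L
      ContinuousLinearMap.adjoint (E.incl K hK).toContinuousLinearMap ∘L P = P := by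
  ext x
  exact E.incl_comp_adjoint_incl_apply K hK (hP x)

theorem comp_incl_adjoint (hs : IsStarProjection P) (hP : ∀ x, P x ∈ K) :
    P ∘L (E.incl K hK).toContinuousLinearMap ∘L
      ContinuousLinearMap.adjoint (E.incl K hK).toContinuousLinearMap = P := by
  have hs : P.adjoint = P := hs.isSelfAdjoint
  have := congrArg ContinuousLinearMap.adjoint (incl_adjoint_comp hK hP)
  rw [adjoint_comp, adjoint_comp, adjoint_adjoint, hs] at this
  rwa [← comp_assoc]

/-- If controlled operators `A` approach `P`, then the compressions `u u* A u u*` approach `u u* P u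
u* = P`. They remain controlled and factor through the locally finite space `K`. -/
theorem mem_roeAlgebra_of_isApprox (hlf : (E.restrict K hK).IsLocallyFinite 𝒴)
    (hdet : (E.restrict K hK).IsDeterminedOnPoints) (hs : IsStarProjection P)
    (hP : ∀ x, P x ∈ K) (ha : IsApprox 𝒴 P) : P ∈ roeAlgebra 𝒴 E := by
  set u := (E.incl K hK).toContinuousLinearMap
  have hc : IsControlled 𝒴 (E := E.restrict K hK) u := E.isControlled_incl K hK
  have key : u ∘L (ContinuousLinearMap.adjoint u ∘L P ∘L u) ∘L ContinuousLinearMap.adjoint u ∈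
      closure (NonUnitalStarAlgebra.adjoin ℂ
        {A : E.H →L[ℂ] E.H | IsLocallyFiniteOp 𝒴 A ∧ IsControlled 𝒴 A} : Set (E.H →L[ℂ] E.H)) := by
    refine mem_closure_of_continuous (f := fun A : E.H →L[ℂ] E.H =>
      u ∘L (ContinuousLinearMap.adjoint u ∘L A ∘L u) ∘L ContinuousLinearMap.adjoint u)
      (by fun_prop) (fun A hA => subset_closure (NonUnitalStarAlgebra.subset_adjoin ℂ _ ?_)) ha
    constructor
    · exact ⟨_, _, E.incl K hK, E.incl K hK, _, hlf, hdet, hc, hlf, hdet, hc, rfl⟩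
    · exact hc.comp ((hc.adjoint.comp (IsControlled.comp hA hc)).comp hc.adjoint)
  have e : u ∘L (ContinuousLinearMap.adjoint u ∘L P ∘L u) ∘L ContinuousLinearMap.adjoint u = P := by
    rw [comp_assoc, comp_assoc, comp_incl_adjoint hK hs hP, incl_adjoint_comp hK hP]
  rwa [e] at key

end ControlledHilbert

/-- The compression of a projection to a locally finite subspace containing its range. -/
def KGen.corner (hlf : (E.restrict K hK).IsLocallyFinite 𝒴)
    (hdet : (E.restrict K hK).IsDeterminedOnPoints) (hs : IsStarProjection P)
    (hP : ∀ x, P x ∈ K) (ha : IsApprox 𝒴 P) : KGen 𝒴 where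
  obj := E.restrict K hK
  locFin := hlf
  det := hdet
  q := ContinuousLinearMap.adjoint (E.incl K hK).toContinuousLinearMap ∘L P ∘L
    (E.incl K hK).toContinuousLinearMap
  approx := (E.isControlled_incl K hK).isApprox.adjoint.comp
    (ha.comp (E.isControlled_incl K hK).isApprox)
  isProj := by
    have h1 : P ∘L P = P := hs.isIdempotentElem
    have h2 : P.adjoint = P := hs.isSelfAdjoint
    refine ⟨?_, ?_⟩
    · have e := comp_incl_adjoint hK hs hP
      rw [IsIdempotentElem, ContinuousLinearMap.mul_def]
      generalize (E.incl K hK).toContinuousLinearMap = u at e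
      calc (ContinuousLinearMap.adjoint u ∘L P ∘L u) ∘L (ContinuousLinearMap.adjoint u ∘L P ∘L u)
          = ContinuousLinearMap.adjoint u ∘L (P ∘L u ∘L ContinuousLinearMap.adjoint u) ∘L P ∘L u := by
            simp only [comp_assoc]
        _ = ContinuousLinearMap.adjoint u ∘L P ∘L u := by rw [e, ← comp_assoc P P, h1]
    · rw [isSelfAdjoint_iff', adjoint_comp, adjoint_comp, adjoint_adjoint, h2, comp_assoc]

variable (hlf : (E.restrict K hK).IsLocallyFinite 𝒴)
    (hdet : (E.restrict K hK).IsDeterminedOnPoints) (hs : IsStarProjection P)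
    (hP : ∀ x, P x ∈ K) (ha : IsApprox 𝒴 P)

/-- The equivalence is implemented by `P u`, where `u` is the inclusion of `K`. -/
theorem KX0.isClassOf_corner : KX0.IsClassOf P (KX0.mk (KGen.corner hK hlf hdet hs hP ha)) := by
  have h1 : P ∘L P = P := hs.isIdempotentElem
  have h2 : P.adjoint = P := hs.isSelfAdjoint
  have e := comp_incl_adjoint hK hs hP
  set u := (E.incl K hK).toContinuousLinearMap
  have e1 : ContinuousLinearMap.adjoint (P ∘L u) ∘L (P ∘L u) =
      ContinuousLinearMap.adjoint u ∘L P ∘L u := by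
    rw [adjoint_comp, h2, comp_assoc, ← comp_assoc P P, h1]
  have e2 : (P ∘L u) ∘L ContinuousLinearMap.adjoint (P ∘L u) = P := by
    rw [adjoint_comp, h2, comp_assoc, ← comp_assoc u, ← comp_assoc P, e, h1]
  exact ⟨KGen.corner hK hlf hdet hs hP ha, P ∘L u,
    ha.comp (E.isControlled_incl K hK).isApprox, e1, e2, rfl⟩

theorem KGen.rankAt_corner {C : Set Y} (hC : 𝒴.IsSummand C) :
    (KGen.corner hK hlf hdet hs hP ha).rankAt C = Module.finrank ℂ (P ∘L E.μ C).range := by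
  have h1 : ∀ x, P (P x) = P x := fun x =>
    congrArg (fun A : E.H →L[ℂ] E.H => A x) hs.isIdempotentElem
  have hcomm : ∀ x, P (E.μ C x) = E.μ C (P x) := fun x =>
    congrArg (fun A : E.H →L[ℂ] E.H => A x) (ha.comm hC)
  set a := KGen.corner hK hlf hdet hs hP ha
  have hq : ∀ z : (E.restrict K hK).H, E.incl K hK (a.q (a.obj.μ C z)) =
      P (E.μ C (E.incl K hK z)) := fun z =>
    E.incl_comp_adjoint_incl_apply K hK (hP (E.μ C (E.incl K hK z)))
  let f : a.obj.H →ₗ[ℂ] E.H := (E.incl K hK).toLinearMap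
  have hf : Function.Injective f := (E.incl K hK).injective
  have hr : (a.q ∘L a.obj.μ C).range.map f = (P ∘L E.μ C).range := by
    apply le_antisymm
    · rintro _ ⟨_, ⟨z, rfl⟩, rfl⟩
      exact ⟨E.incl K hK z, (hq z).symm⟩
    · rintro _ ⟨x, rfl⟩
      -- Replacing `x` by `P x ∈ K` does not change `P μ(C) x`, because `P` commutes with `μ(C)`.
      refine ⟨_, ⟨(⟨P x, hP x⟩ : K), rfl⟩, (hq _).trans ?_⟩
      change P (E.μ C (P x)) = P (E.μ C x)
      rw [← hcomm, h1]
  rw [← hr]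
  exact (Submodule.equivMapOfInjective f hf (a.q ∘L a.obj.μ C).range).finrank_eq

end Corner

/-- A linear isometry with a right inverse is a coisometry. -/
theorem LinearIsometry.comp_adjoint_of_rightInverse {H : Type*} [NormedAddCommGroup H]
    [InnerProductSpace ℂ H] [CompleteSpace H] {V W : H →ₗᵢ[ℂ] H} (h : ∀ x, V (W x) = x) :
    V.toContinuousLinearMap ∘L ContinuousLinearMap.adjoint V.toContinuousLinearMap =
      ContinuousLinearMap.id ℂ H := by
  have h1 := (ContinuousLinearMap.norm_map_iff_adjoint_comp_self V.toContinuousLinearMap).1 V.norm_map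
  ext x
  have := congrArg (fun A : H →L[ℂ] H => V (A (W x))) h1
  change V (ContinuousLinearMap.adjoint V.toContinuousLinearMap (V (W x))) = V (W x) at this
  rwa [h] at this

theorem drutuNowak_mem_fibrewiseConst {X : Type u} [MeasurableSpace X] {ν : Measure X}
    (f : Lp ℂ 2 (nuHat ν)) : drutuNowak ν f ∈ fibrewiseConst ν :=
  Submodule.starProjection_apply_mem _ _

theorem isStarProjection_drutuNowak {X : Type u} [MeasurableSpace X] (ν : Measure X) :
    IsStarProjection (drutuNowak ν) :=
  isStarProjection_starProjection

theorem SqQuot.isEntourage_of_sq {X : Type u} [UniformSpace X] {𝒳 : BornCoarse X} {G : Type v}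
    [Group G] [MulAction G X] [UniformContinuousConstSMul G X]
    (hact : ∀ g : G, 𝒳.IsMorphism 𝒳 (fun x => g • x)) {U : SetRel (ℤ × X) (ℤ × X)}
    (hU : (Sq 𝒳).IsEntourage U) : (SqQuot 𝒳 hact).IsEntourage U :=
  .basic (Or.inl hU)

/-! ## The controlled Hilbert space of a partition -/

namespace PartitionData

variable {X : Type u} [UniformSpace X] [MeasurableSpace X] {𝒳 : BornCoarse X} {ν : Measure X}
  {ι : Type w} (D : PartitionData 𝒳 ν ι)

/-- Two points are related if they are in the same cell of the partition. -/
def cellRel : SetRel (ℤ × X) (ℤ × X) := {p | ∃ i, p.1 ∈ D.B i ∧ p.2 ∈ D.B i}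

/-- Two points of a cell are joined through the point `y` with `B i ⊆ V²[y]`, so `V² ○ (V²)⁻¹`
contains the relation. -/
theorem cellRel_isEntourage : (Sq 𝒳).IsEntourage D.cellRel := by
  have hV := (Sq 𝒳).comp D.V_entourage D.V_entourage
  refine (Sq 𝒳).mono ((Sq 𝒳).comp hV ((Sq 𝒳).inv hV)) ?_
  rintro ⟨p, q⟩ ⟨i, hp, hq⟩
  obtain ⟨y, hy⟩ := D.B_bdd i
  obtain ⟨_, rfl, h1⟩ := hy hp
  obtain ⟨_, rfl, h2⟩ := hy hq
  exact ⟨_, h1, h2⟩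

theorem fst_eq_of_mem {i : ι} {p : ℤ × X} (hp : p ∈ D.B i) : p.1 = (D.b i).1 := by
  obtain ⟨⟨U, -, h⟩, -⟩ := (isSqEntourage_iff 𝒳 _).1 D.cellRel_isEntourage
  exact (h (p, D.b i) ⟨i, hp, D.b_mem i⟩).1

theorem ae_mem_iUnion : ∀ᵐ p ∂(nuHat ν), ∃ i, p ∈ D.B i := by
  have hf : ∀ᵐ p ∂(nuHat ν), p ∈ ⋃ i, D.B i := D.B_full
  filter_upwards [hf] with p hp using mem_iUnion.1 hp

/-- The functions which are constant on the cells of the partition. -/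
def blockConst : Submodule ℂ (Lp ℂ 2 (nuHat ν)) where
  carrier := {f | ∃ c : ι → ℂ, ∀ᵐ p ∂(nuHat ν), ∀ i, p ∈ D.B i → f p = c i}
  add_mem' := by
    rintro f g ⟨c, hc⟩ ⟨d, hd⟩
    refine ⟨c + d, ?_⟩
    filter_upwards [hc, hd, Lp.coeFn_add f g] with p h1 h2 h3 i hi
    rw [h3, Pi.add_apply, h1 i hi, h2 i hi, Pi.add_apply]
  zero_mem' := ⟨0, by
    filter_upwards [Lp.coeFn_zero ℂ 2 (nuHat ν)] with p hp i _
    rw [hp]; rfl⟩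
  smul_mem' := by
    rintro a f ⟨c, hc⟩
    refine ⟨a • c, ?_⟩
    filter_upwards [hc, Lp.coeFn_smul a f] with p h1 h2 i hi
    rw [h2, Pi.smul_apply, h1 i hi, Pi.smul_apply]

theorem blockConst_isClosed : IsClosed (D.blockConst : Set (Lp ℂ 2 (nuHat ν))) := by
  refine IsSeqClosed.isClosed fun f g hf hg => ?_
  choose c hc using hf
  obtain ⟨ns, -, hns⟩ := (tendstoInMeasure_of_tendsto_Lp hg).exists_seq_tendsto_ae
  -- Along an almost everywhere convergent subsequence the cell constants converge for every cell
  -- containing a good point of convergence; the value of `limUnder` on any other cell is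
  -- irrelevant.
  refine ⟨fun i => limUnder atTop fun k => c (ns k) i, ?_⟩
  filter_upwards [hns, ae_all_iff.2 hc] with p h1 h2 i hi
  have h3 : ∀ k, f (ns k) p = c (ns k) i := fun k => h2 (ns k) i hi
  simp only [h3] at h1
  exact h1.limUnder_eq.symm

theorem fibrewiseConst_le_blockConst : fibrewiseConst ν ≤ D.blockConst := by
  rintro f ⟨c, hc⟩
  refine ⟨fun i => c (D.b i).1, ?_⟩
  filter_upwards [hc] with p hp i hi
  rw [hp, D.fst_eq_of_mem hi]

variable [SFinite ν]

theorem mulInd_cells_apply (S : Set (ℤ × X)) (f : Lp ℂ 2 (nuHat ν)) :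
    ∀ᵐ p ∂(nuHat ν), ∀ i, p ∈ D.B i →
      (D.b i ∈ S → mulInd (nuHat ν) (D.cells_meas S) f p = f p) ∧
      (D.b i ∉ S → mulInd (nuHat ν) (D.cells_meas S) f p = 0) := by
  filter_upwards [mulInd_coe (nuHat ν) (D.cells_meas S) f] with p hp i hi
  rw [hp]
  exact ⟨fun h => indicator_of_mem ((D.mem_cells hi S).2 h) _,
    fun h => indicator_of_notMem (fun h' => h ((D.mem_cells hi S).1 h')) _⟩

/-- At almost every `p`, with `p ∈ B j` and `φ p ∈ B i`, the value can only be nonzero if `b j ∈ T`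
and `b i ∈ S`. This turns control of a composition operator into a statement about base points. -/
theorem mulInd_pullback_mulInd_eq_zero {φ : ℤ × X → ℤ × X}
    (hφ : MeasurePreserving φ (nuHat ν) (nuHat ν)) {S T : Set (ℤ × X)}
    (h : ∀ i j p, p ∈ D.B j → φ p ∈ D.B i → D.b i ∈ S → D.b j ∉ T) :
    mulInd (nuHat ν) (D.cells_meas T) ∘L
      (Lp.compMeasurePreservingₗᵢ ℂ φ hφ).toContinuousLinearMap ∘L
        mulInd (nuHat ν) (D.cells_meas S) = 0 := by
  ext1 f
  refine Lp.ext ?_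
  filter_upwards [D.ae_mem_iUnion, hφ.quasiMeasurePreserving.ae D.ae_mem_iUnion,
    hφ.quasiMeasurePreserving.ae (D.mulInd_cells_apply S f),
    pullback_coe hφ (mulInd (nuHat ν) (D.cells_meas S) f),
    D.mulInd_cells_apply T (Lp.compMeasurePreservingₗᵢ ℂ φ hφ
      (mulInd (nuHat ν) (D.cells_meas S) f)), Lp.coeFn_zero ℂ 2 (nuHat ν)] with p h1 h2 h3 h4 h5 h6
  obtain ⟨j, hj⟩ := h1
  obtain ⟨i, hi⟩ := h2
  refine Eq.trans ?_ h6.symm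
  by_cases hT : D.b j ∈ T
  · refine ((h5 j hj).1 hT).trans (h4.trans ((h3 i hi).2 fun hS => h i j p hj hi hS hT))
  · exact (h5 j hj).2 hT

section Act

variable {G : Type v} [Group G] [MulAction G X] [UniformContinuousConstSMul G X]
  (hact : ∀ g : G, 𝒳.IsMorphism 𝒳 (fun x => g • x))

theorem isControlled_rhoHat [MeasurableConstSMul G X] [SMulInvariantMeasure G X ν] (g : G) :
    IsControlled (SqQuot 𝒳 hact) (E := D.hilbert) (E' := D.hilbert)
      (rhoHat ν g).toContinuousLinearMap := by
  have hC := SqQuot.isEntourage_of_sq hact D.cellRel_isEntourage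
  have hg : (SqQuot 𝒳 hact).IsEntourage {p | p.1 = sqAct G X g p.2} := .basic (Or.inr ⟨g, rfl⟩)
  -- The chain is `b j ~ p = g (g⁻¹ p)`, then `g⁻¹ p ~ b i`, where `~` means lying in the same cell.
  refine ⟨_, (SqQuot 𝒳 hact).comp hC ((SqQuot 𝒳 hact).comp hg hC), fun S T hST =>
    D.mulInd_pullback_mulInd_eq_zero _ fun i j p hj hi hS hT => ?_⟩
  refine Set.disjoint_left.1 hST hT ⟨D.b i, hS, p, ⟨j, D.b_mem j, hj⟩, sqAct G X g⁻¹ p, ?_,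
    ⟨i, hi, D.b_mem i⟩⟩
  change p = sqAct G X g (sqAct G X g⁻¹ p)
  rw [← Equiv.Perm.mul_apply, ← map_mul, mul_inv_cancel, map_one]
  rfl

/-- The translation on `L²(ℤ × X)`, as an operator into the push-forward along the shift. -/
theorem isControlled_shift (k : ℤ) :
    IsControlled (SqQuot 𝒳 hact) (E := D.hilbert) (E' := D.hilbert.push (shift X k))
      (Lp.compMeasurePreservingₗᵢ ℂ (shift X k)
        (measurePreserving_shift (ν := ν) k)).toContinuousLinearMap := by
  have hC := SqQuot.isEntourage_of_sq hact D.cellRel_isEntourage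
  -- In the push-forward the base point of cell `j` is the shift of `b j`; it is related to the
  -- shift of `p` by the shifted cell relation, and the shift of `p` shares a cell with `b i`.
  refine ⟨_, (SqQuot 𝒳 hact).comp ((shift_isMorphism 𝒳 hact k).controlled _ hC) hC,
    fun S T hST => D.mulInd_pullback_mulInd_eq_zero _ fun i j p hj hi hS hT => ?_⟩
  exact Set.disjoint_left.1 hST hT ⟨D.b i, hS, shift X k p,
    ⟨(D.b j, p), ⟨j, D.b_mem j, hj⟩, rfl⟩, ⟨i, hi, D.b_mem i⟩⟩

end Act

/-- `blockConst` as a subspace of the controlled Hilbert space of the partition. -/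
def blocks : Submodule ℂ D.hilbert.H := D.blockConst

instance : CompleteSpace D.blocks := D.blockConst_isClosed.completeSpace_coe

theorem μ_mem_blocks (S : Set (ℤ × X)) (f : D.hilbert.H) (hf : f ∈ D.blocks) :
    D.hilbert.μ S f ∈ D.blocks := by
  classical
  obtain ⟨c, hc⟩ := hf
  refine ⟨fun i => if D.b i ∈ S then c i else 0, ?_⟩
  filter_upwards [hc, D.mulInd_cells_apply S f] with p h1 h2 i hi
  split_ifs with h
  · exact ((h2 i hi).1 h).trans (h1 i hi)
  · exact (h2 i hi).2 h

/-- Only countably many cells are needed to cover almost everything, so a function whose restriction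
to each of them vanishes is zero. -/
theorem blocks_isDeterminedOnPoints :
    (D.hilbert.restrict D.blocks D.μ_mem_blocks).IsDeterminedOnPoints := by
  refine isDeterminedOnPoints_restrict _ _ _ fun (f : Lp ℂ 2 (nuHat ν)) _ h => ?_
  have hcount := D.countable
  have h' : ∀ i, mulInd (nuHat ν) (D.cells_meas {D.b i}) f = 0 := fun i => h (D.b i)
  refine Lp.ext ?_
  filter_upwards [D.ae_mem_iUnion, ae_all_iff.2 fun i => D.mulInd_cells_apply {D.b i} f,
    Lp.coeFn_zero ℂ 2 (nuHat ν)] with p h1 h2 h3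
  obtain ⟨i, hi⟩ := h1
  have := (h2 i i hi).1 rfl
  rw [h' i] at this
  exact this.symm

end PartitionData

/-! ### Local finiteness, approximation by averages, and the class of the projection -/

namespace PartitionData

variable {X : Type u} [UniformSpace X] [MeasurableSpace X] {𝒳 : BornCoarse X} {ν : Measure X}
  {ι : Type w} (D : PartitionData 𝒳 ν ι) [IsProbabilityMeasure ν]

theorem nuHat_B_ne_top (i : ι) : nuHat ν (D.B i) ≠ ⊤ := by
  refine ne_top_of_le_ne_top ?_ (measure_mono (t := component X (D.b i).1) fun p hp =>
    D.fst_eq_of_mem hp)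
  simp [nuHat_component]

/-- The inner product is the measure of the cell times the constant value there, and this measure is
positive and finite. -/
theorem ae_eq_zero_of_inner_eq_zero {f : Lp ℂ 2 (nuHat ν)} (hf : f ∈ D.blockConst) (i : ι)
    (h : ⟪indicatorConstLp 2 (D.B_meas i) (D.nuHat_B_ne_top i) (1 : ℂ), f⟫_ℂ = 0) :
    ∀ᵐ p ∂(nuHat ν), p ∈ D.B i → f p = 0 := by
  obtain ⟨c, hc⟩ := hf
  rw [L2.inner_indicatorConstLp_one, setIntegral_congr_ae (g := fun _ => c i) (D.B_meas i)
    (hc.mono fun p hp hi => hp i hi), setIntegral_const] at h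
  have h0 : (nuHat ν).real (D.B i) ≠ 0 :=
    (ENNReal.toReal_pos (D.B_pos i).ne' (D.nuHat_B_ne_top i)).ne'
  have hci : c i = 0 := (smul_eq_zero.1 h).resolve_left h0
  filter_upwards [hc] with p hp hi
  rw [hp i hi, hci]

theorem blocks_isLocallyFinite {G : Type v} [Group G] [MulAction G X]
    [UniformContinuousConstSMul G X] (hact : ∀ g : G, 𝒳.IsMorphism 𝒳 (fun x => g • x)) :
    (D.hilbert.restrict D.blocks D.μ_mem_blocks).IsLocallyFinite (SqQuot 𝒳 hact) := by
  intro S hS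
  have hfin : Finite {i | D.b i ∈ S} := (D.b_locFin S hS).to_subtype
  let e : ι → D.hilbert.H := fun i =>
    indicatorConstLp 2 (D.B_meas i) (D.nuHat_B_ne_top i) (1 : ℂ)
  -- `Φ` records the integrals over the finitely many cells with base point in `S`. A blockwise
  -- constant function supported on these cells is determined by them, so `Φ` embeds the space in a
  -- finite-dimensional one.
  let Φ : ((D.hilbert.restrict D.blocks D.μ_mem_blocks).μ S).range →ₗ[ℂ] ({i | D.b i ∈ S} → ℂ) :=
    LinearMap.pi fun i => (innerSL ℂ (e i)).toLinearMap ∘ₗ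
      (D.hilbert.incl D.blocks D.μ_mem_blocks).toLinearMap ∘ₗ Submodule.subtype _
  refine Module.Finite.of_injective Φ ?_
  rw [← LinearMap.ker_eq_bot, LinearMap.ker_eq_bot']
  rintro ⟨x, x', hx⟩ h0
  have h1 : ∀ i, D.b i ∈ S → ⟪e i, D.hilbert.incl D.blocks D.μ_mem_blocks x⟫_ℂ = 0 :=
    fun i hi => congrFun h0 ⟨i, hi⟩
  have hxK : D.hilbert.incl D.blocks D.μ_mem_blocks x ∈ D.blockConst :=
    Subtype.property (p := (· ∈ D.blocks)) x
  have hx2 : D.hilbert.μ S (D.hilbert.incl D.blocks D.μ_mem_blocks x') =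
      D.hilbert.incl D.blocks D.μ_mem_blocks x :=
    congrArg (D.hilbert.incl D.blocks D.μ_mem_blocks) hx
  refine Subtype.ext ((D.hilbert.incl D.blocks D.μ_mem_blocks).injective ?_)
  change D.hilbert.incl D.blocks D.μ_mem_blocks x = D.hilbert.incl D.blocks D.μ_mem_blocks 0
  rw [map_zero]
  generalize D.hilbert.incl D.blocks D.μ_mem_blocks x = f at *
  generalize D.hilbert.incl D.blocks D.μ_mem_blocks x' = f' at *
  change Lp ℂ 2 (nuHat ν) at f f'
  have hcount := D.countable
  have h2 : ∀ i, D.b i ∈ S → ∀ᵐ p ∂(nuHat ν), p ∈ D.B i → f p = 0 :=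
    fun i hi => D.ae_eq_zero_of_inner_eq_zero hxK i (h1 i hi)
  refine Lp.ext ?_
  filter_upwards [D.ae_mem_iUnion, ae_all_iff.2 fun i => ae_all_iff.2 (h2 i),
    D.mulInd_cells_apply S f', Lp.coeFn_zero ℂ 2 (nuHat ν)] with p h3 h4 h5 h6
  obtain ⟨i, hi⟩ := h3
  refine Eq.trans ?_ h6.symm
  by_cases hS : D.b i ∈ S
  · exact h4 i hS hi
  · have := (h5 i hi).2 hS
    rwa [show mulInd (nuHat ν) (D.cells_meas S) f' = f from hx2] at this

theorem drutuNowak_mem_blocks (f : Lp ℂ 2 (nuHat ν)) : drutuNowak ν f ∈ D.blocks :=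
  D.fibrewiseConst_le_blockConst (drutuNowak_mem_fibrewiseConst f)

variable {G : Type v} [Group G] [MulAction G X] [UniformContinuousConstSMul G X]
  (hact : ∀ g : G, 𝒳.IsMorphism 𝒳 (fun x => g • x))

theorem isApprox_drutuNowak [MeasurableConstSMul G X] [ErgodicSMul G X ν]
    (hgap : HasSpectralGap G ν) :
    IsApprox (SqQuot 𝒳 hact) (E := D.hilbert) (E' := D.hilbert) (drutuNowak ν) := by
  obtain ⟨S, hS⟩ := exists_tendsto_drutuNowak hgap
  refine mem_closure_of_tendsto hS (Eventually.of_forall fun k => ?_)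
  have h : IsControlled (SqQuot 𝒳 hact) (E := D.hilbert) (E' := D.hilbert)
      (lazyAverage S (rhoHat ν)) :=
    IsControlled.smul (IsControlled.sum S fun g _ =>
      (isControlled_id _ _).add (D.isControlled_rhoHat hact g)) _
  exact h.pow k

theorem finrank_drutuNowak_component (P : D.hilbert.H →L[ℂ] D.hilbert.H)
    (hP : P = drutuNowak ν) (n : ℤ)
    (hcomm : P ∘L D.hilbert.μ (component X n) = D.hilbert.μ (component X n) ∘L P) :
    Module.finrank ℂ (P ∘L D.hilbert.μ (component X n)).range = 1 := by
  have hfin : nuHat ν (component X n) ≠ ⊤ := by simp [nuHat_component]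
  let e : D.hilbert.H := indicatorConstLp 2 (component_meas n) hfin (1 : ℂ)
  have he := indicatorConstLp_coeFn (p := 2) (hs := component_meas n) (hμs := hfin) (c := (1 : ℂ))
  have heP : P e = e := by
    have h : drutuNowak ν (indicatorConstLp 2 (component_meas n) hfin (1 : ℂ)) =
        indicatorConstLp 2 (component_meas n) hfin (1 : ℂ) :=
      Submodule.starProjection_eq_self_iff.2 (indicator_component_mem_fibrewiseConst n hfin)
    rw [hP]
    exact h
  have hmul : ∀ f : Lp ℂ 2 (nuHat ν), ∀ᵐ p ∂(nuHat ν),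
      (p.1 = n → mulInd (nuHat ν) (D.cells_meas (component X n)) f p = f p) ∧
      (p.1 ≠ n → mulInd (nuHat ν) (D.cells_meas (component X n)) f p = 0) := fun f => by
    filter_upwards [D.mulInd_cells_apply (component X n) f, D.ae_mem_iUnion] with p h1 ⟨i, hi⟩
    rw [D.fst_eq_of_mem hi]
    exact h1 i hi
  have heC : D.hilbert.μ (component X n) e = e := by
    refine Lp.ext ?_
    filter_upwards [hmul e, he] with p h1 h2
    by_cases h : p.1 = n
    · exact h1.1 h
    · exact (h1.2 h).trans (h2.trans (indicator_of_notMem (show p ∉ component X n from h) _)).symm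
  have hne : e ≠ 0 := by
    intro h
    have h1 := norm_indicatorConstLp (p := 2) (hs := component_meas n) (hμs := hfin) (c := (1 : ℂ))
      two_ne_zero ENNReal.ofNat_ne_top
    rw [show indicatorConstLp 2 (component_meas n) hfin (1 : ℂ) = 0 from h] at h1
    simp [Measure.real, nuHat_component] at h1
  -- After commuting, the operator first makes a function fibrewise constant and then cuts it off to
  -- the `n`-th component, which leaves a multiple of `e`.
  have hr : (P ∘L D.hilbert.μ (component X n)).range = Submodule.span ℂ {e} := by
    apply le_antisymm
    · rintro _ ⟨f, rfl⟩
      have h1 : P f ∈ fibrewiseConst ν := by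
        rw [hP]; exact drutuNowak_mem_fibrewiseConst f
      obtain ⟨c, hc⟩ := h1
      rw [Submodule.mem_span_singleton]
      refine ⟨c n, ?_⟩
      rw [hcomm]
      refine Lp.ext ?_
      filter_upwards [hmul (P f), hc, he, Lp.coeFn_smul (c n)
        (indicatorConstLp 2 (component_meas n) hfin (1 : ℂ))] with p h1 h2 h3 h4
      refine h4.trans ?_
      rw [Pi.smul_apply, h3]
      by_cases h : p.1 = n
      · refine Eq.trans ?_ (h1.1 h).symm
        rw [h2, h, indicator_of_mem (show p ∈ component X n from h), smul_eq_mul, mul_one]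
      · refine Eq.trans ?_ (h1.2 h).symm
        rw [indicator_of_notMem (show p ∉ component X n from h), smul_zero]
    · rw [Submodule.span_singleton_le_iff_mem]
      refine ⟨e, ?_⟩
      change P (D.hilbert.μ (component X n) e) = e
      rw [heC, heP]
  rw [hr]
  exact finrank_span_singleton hne

/-- The class of the Drutu-Nowak projection is determined by the projection, invariant under the
shifts, and of trace one on every component. -/
theorem exists_class_drutuNowak [MeasurableConstSMul G X] [ErgodicSMul G X ν]
    (hbdd : 𝒳.IsBdd univ) (hgap : HasSpectralGap G ν) :
    ∃ p : KX0 (SqQuot 𝒳 hact),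
      (∀ c, KX0.IsClassOf (E := D.hilbert) (drutuNowak ν) c ↔ c = p) ∧
      (∀ k : ℤ, KX0.map (shift_isMorphism 𝒳 hact k) p = p) ∧
      ∀ n : ℤ, KX0.traceAt (component_isBdd 𝒳 hbdd hact n) (component_isSummand 𝒳 hact n) p = 1 := by
  have ha := D.isApprox_drutuNowak hact hgap
  have hs := isStarProjection_drutuNowak ν
  have hcl := KX0.isClassOf_corner D.μ_mem_blocks (D.blocks_isLocallyFinite hact)
    D.blocks_isDeterminedOnPoints hs D.drutuNowak_mem_blocks ha
  refine ⟨_, fun c => ⟨fun h => h.unique hcl, fun h => h ▸ hcl⟩, fun k => ?_, fun n => ?_⟩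
  -- The shifted class is the class of the same operator on the push-forward. By uniqueness it
  -- suffices that the original class also represents this operator, which follows by transport
  -- along `V P`, with `V` the unitary translation.
  · refine (hcl.push (shift_isMorphism 𝒳 hact k)).unique ?_
    let V : Lp ℂ 2 (nuHat ν) →ₗᵢ[ℂ] Lp ℂ 2 (nuHat ν) :=
      Lp.compMeasurePreservingₗᵢ ℂ (shift X k) (measurePreserving_shift (ν := ν) k)
    let W : Lp ℂ 2 (nuHat ν) →ₗᵢ[ℂ] Lp ℂ 2 (nuHat ν) :=
      Lp.compMeasurePreservingₗᵢ ℂ (shift X (-k)) (measurePreserving_shift (ν := ν) (-k))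
    have hVW : ∀ f, V (W f) = f := pullback_pullback (measurePreserving_shift k)
      (measurePreserving_shift (-k)) fun p => by simp [shift]
    have h1 := (ContinuousLinearMap.norm_map_iff_adjoint_comp_self V.toContinuousLinearMap).1 V.norm_map
    have h2 := LinearIsometry.comp_adjoint_of_rightInverse hVW
    have h3 : drutuNowak ν ∘L drutuNowak ν = drutuNowak ν := hs.isIdempotentElem
    have h4 : ContinuousLinearMap.adjoint (drutuNowak ν) = drutuNowak ν := hs.isSelfAdjoint
    have h5 : V.toContinuousLinearMap ∘L drutuNowak ν = drutuNowak ν ∘L V.toContinuousLinearMap := by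
      ext1 f
      exact (starProjection_comp_isometry (K := fibrewiseConst ν) (V := V) (W := W) hVW
        (fun f hf => pullback_mem_fibrewiseConst (e := (· + k)) (measurePreserving_shift k)
          (fun _ => rfl) hf)
        (fun f hf => pullback_mem_fibrewiseConst (e := (· + -k)) (measurePreserving_shift (-k))
          (fun _ => rfl) hf) f).symm
    have e1 : ContinuousLinearMap.adjoint (V.toContinuousLinearMap ∘L drutuNowak ν) ∘L
        (V.toContinuousLinearMap ∘L drutuNowak ν) = drutuNowak ν := by
      rw [adjoint_comp, h4, comp_assoc, ← comp_assoc _ V.toContinuousLinearMap, h1, one_def, id_comp, h3]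
    have e2 : (V.toContinuousLinearMap ∘L drutuNowak ν) ∘L
        ContinuousLinearMap.adjoint (V.toContinuousLinearMap ∘L drutuNowak ν) = drutuNowak ν := by
      rw [h5, adjoint_comp, h4, comp_assoc, ← comp_assoc V.toContinuousLinearMap, h2, id_comp, h3]
    have e3 : (V.toContinuousLinearMap ∘L drutuNowak ν) ∘L drutuNowak ν =
        V.toContinuousLinearMap ∘L drutuNowak ν := by
      rw [comp_assoc, h3]
    exact hcl.transport (E' := D.hilbert.push (shift X k)) (V.toContinuousLinearMap ∘L drutuNowak ν)
      ((D.isControlled_shift hact k).isApprox.comp ha) e1 e2 e3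
  · have h1 := KGen.rankAt_corner D.μ_mem_blocks (D.blocks_isLocallyFinite hact)
      D.blocks_isDeterminedOnPoints hs D.drutuNowak_mem_blocks ha (component_isSummand 𝒳 hact n)
    rw [D.finrank_drutuNowak_component _ rfl n (ha.comm (component_isSummand 𝒳 hact n))] at h1
    simp [KX0.traceAt, KX0.mk, h1]

end PartitionData

end

/-! ## Existence of partitions -/

/-- Each component is covered by finitely many small open sets, the cover is made disjoint, and null
pieces are dropped. Full support ensures that the remaining base points are still dense. -/
theorem exists_partitionData {X : Type u} [UniformSpace X] (𝒳 : BornCoarse X)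
    (hmax : 𝒳.IsEntourage univ)
    (hfin : ∀ V ∈ 𝓤 X, ∃ F : Set X, F.Finite ∧ ∀ x, ∃ y ∈ F, (x, y) ∈ V)
    (hscale : ∃ U : ℕ → SetRel X X, IsUniformScale U)
    [MeasurableSpace X] [BorelSpace X] (ν : Measure X) [IsProbabilityMeasure ν]
    [ν.IsOpenPosMeasure] : ∃ ι : Type, Nonempty (PartitionData 𝒳 ν ι) := by
  classical
  obtain ⟨U, hU, hUc⟩ := hscale
  -- The scale enters through countable generation, which provides a decreasing basis of symmetric
  -- entourages `W`.
  have hbasis : (𝓤 X).HasBasis (fun _ : ℕ => True) U :=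
    ⟨fun t => ⟨fun ht => (hUc t ht).imp fun n hn => ⟨trivial, hn⟩,
      fun ⟨n, _, hn⟩ => mem_of_superset (hU n) hn⟩⟩
  have : (𝓤 X).IsCountablyGenerated := hbasis.isCountablyGenerated
  obtain ⟨W, hW, hWs⟩ := UniformSpace.has_seq_basis X
  have hWm : ∀ n, W n ∈ 𝓤 X := hW.mem
  choose F hF hFW using fun n => hfin _ (interior_mem_uniformity (hWm n))
  choose N f hf hfF using fun n => (hF n).fin_param
  -- Interiors of entourages make these sets open, hence measurable. They are empty for `j ≥ N n`,
  -- so that `disjointed` can be applied to a sequence indexed by `ℕ`.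
  let O : ℕ → ℕ → Set X := fun n j => {x | ∃ h : j < N n, (x, f n ⟨j, h⟩) ∈ interior (W n)}
  have hOpen : ∀ n j, IsOpen (O n j) := fun n j => by
    by_cases h : j < N n
    · have : O n j = (fun x => (x, f n ⟨j, h⟩)) ⁻¹' interior (W n) := by ext x; simp [O, h]
      rw [this]
      exact isOpen_interior.preimage (by fun_prop)
    · have : O n j = ∅ := by ext x; simp [O, h]
      rw [this]
      exact isOpen_empty
  let A : ℕ → ℕ → Set X := fun n => disjointed (O n)
  have hAm : ∀ n j, MeasurableSet (A n j) := fun n =>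
    MeasurableSet.disjointed fun j => (hOpen n j).measurableSet
  have hAO : ∀ n j, A n j ⊆ O n j := fun n => disjointed_subset (O n)
  have hAU : ∀ n x, ∃ j, x ∈ A n j := fun n x => by
    have : x ∈ ⋃ j, A n j := by
      rw [show ⋃ j, A n j = ⋃ j, O n j from iUnion_disjointed]
      obtain ⟨y, hy, hxy⟩ := hFW n x
      rw [← hfF n] at hy
      obtain ⟨j, rfl⟩ := hy
      exact mem_iUnion.2 ⟨j, j.2, hxy⟩
    exact mem_iUnion.1 this
  let ι := {p : ℤ × ℕ // 0 < ν (A p.1.toNat p.2)}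
  have hne : ∀ i : ι, (A i.1.1.toNat i.1.2).Nonempty := fun i => nonempty_of_measure_ne_zero i.2.ne'
  choose b hb using hne
  -- Components with `n ≤ 0` all use `W 0`; the squeezing condition only concerns `n → ∞`.
  let V : SetRel (ℤ × X) (ℤ × X) := {p | p.1.1 = p.2.1 ∧ (p.1.2, p.2.2) ∈ W p.1.1.toNat}
  have hVrefl : ∀ p, (p, p) ∈ V := fun p => ⟨rfl, refl_mem_uniformity (hWm _)⟩
  let B : ι → Set (ℤ × X) := fun i => {i.1.1} ×ˢ A i.1.1.toNat i.1.2
  have hfull : ∀ᵐ p ∂(nuHat ν), p ∈ ⋃ i, B i := by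
    rw [ae_nuHat_iff]
    intro n
    have h : ∀ j, ∀ᵐ x ∂ν, x ∈ A n.toNat j → 0 < ν (A n.toNat j) := fun j => by
      by_cases h0 : ν (A n.toNat j) = 0
      · filter_upwards [measure_eq_zero_iff_ae_notMem.1 h0] with x hx hx' using absurd hx' hx
      · exact Eventually.of_forall fun _ _ => pos_iff_ne_zero.2 h0
    filter_upwards [ae_all_iff.2 h] with x hx
    obtain ⟨j, hj⟩ := hAU n.toNat x
    exact mem_iUnion.2 ⟨⟨(n, j), hx j hj⟩, rfl, hj⟩
  have hV : (Sq 𝒳).IsEntourage V := by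
    refine (isSqEntourage_iff 𝒳 V).2 ⟨⟨univ, hmax, fun p hp => ⟨hp.1, mem_univ _⟩⟩, fun V' hV' => ?_⟩
    obtain ⟨m, hm⟩ := hW.mem_iff.1 hV'
    exact ⟨m, fun n hn p hp => hm (hW.antitone (show m ≤ n.toNat by omega) hp.2)⟩
  refine ⟨ι, ⟨{
    V := V
    V_entourage := hV
    V_uniform := fun n => mem_of_superset (hWm n.toNat) fun p hp => ⟨rfl, hp⟩
    B := B
    B_meas := fun i => (measurableSet_singleton _).prod (hAm _ _)
    B_disj := ?_
    B_full := hfull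
    B_bdd := ?_
    B_pos := fun i => ?_
    b := fun i => (i.1.1, b i)
    b_mem := fun i => ⟨rfl, hb i⟩
    b_locFin := ?_
    b_dense := ?_ }⟩⟩
  · rintro ⟨⟨n, j⟩, hi⟩ ⟨⟨m, k⟩, hi'⟩ hij
    refine Set.disjoint_left.2 ?_
    rintro ⟨l, x⟩ ⟨h1, h2⟩ ⟨h3, h4⟩
    obtain rfl : l = n := h1
    obtain rfl : l = m := h3
    have hjk : j ≠ k := fun h => hij (by subst h; rfl)
    exact Set.disjoint_left.1 (disjoint_disjointed (O l.toNat) hjk) h2 h4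
  · rintro ⟨⟨n, j⟩, hi⟩
    obtain ⟨h, -⟩ := hAO _ _ (hb ⟨(n, j), hi⟩)
    -- The cell lies in the `V`-ball around its centre; the second factor of `V²` is filled by
    -- reflexivity.
    refine ⟨(n, f n.toNat ⟨j, h⟩), ?_⟩
    rintro ⟨l, x⟩ ⟨h1, h2⟩
    obtain rfl : l = n := h1
    obtain ⟨_, hx⟩ := hAO _ _ h2
    exact ⟨_, rfl, (l, f l.toNat ⟨j, h⟩), ⟨rfl, interior_subset hx⟩, hVrefl _⟩
  · rw [Measure.prod_prod, Measure.count_singleton, one_mul]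
    exact i.2
  · intro S hS
    obtain ⟨K, C, hK, -, hSK⟩ := (sqBornology_isBounded 𝒳 S).1 hS
    have hfinite : (⋃ n ∈ K, {n} ×ˢ Iio (N n.toNat) : Set (ℤ × ℕ)).Finite :=
      hK.biUnion fun n _ => (finite_singleton n).prod (finite_Iio _)
    refine (hfinite.preimage Subtype.val_injective.injOn).subset fun i hi => ?_
    obtain ⟨h, -⟩ := hAO _ _ (hb i)
    exact mem_biUnion (hSK hi).1 ⟨rfl, h⟩
  · rintro ⟨n, x⟩
    -- As `ν` has full support, the ball around `x` meets a cell that was not dropped, in a point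
    -- `z`. The path from `x` to `z`, to the centre of that cell and to its base point uses three
    -- steps of `V`; the other two are trivial.
    have h1 : 0 < ν {z | (x, z) ∈ W n.toNat} :=
      Measure.measure_pos_of_mem_nhds ν (UniformSpace.ball_mem_nhds x (hWm _))
    obtain ⟨z, hz, hz'⟩ := Measure.exists_mem_of_measure_ne_zero_of_ae h1.ne'
      (ae_restrict_of_ae (ae_nuHat_iff.1 hfull n))
    obtain ⟨⟨⟨m, j⟩, hi⟩, h2, h3⟩ := mem_iUnion.1 hz'
    obtain rfl : n = m := h2
    obtain ⟨h, hzf⟩ := hAO _ _ h3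
    obtain ⟨_, hbf⟩ := hAO _ _ (hb ⟨(n, j), hi⟩)
    have hsymm : (f n.toNat ⟨j, h⟩, b ⟨(n, j), hi⟩) ∈ W n.toNat := by
      have := hWs n.toNat
      exact SetRel.symm _ (interior_subset hbf)
    exact ⟨⟨(n, j), hi⟩, _, ⟨(n, b ⟨(n, j), hi⟩), ⟨(n, f n.toNat ⟨j, h⟩), ⟨(n, z), ⟨rfl, hz⟩,
      ⟨rfl, interior_subset hzf⟩⟩, ⟨rfl, hsymm⟩⟩, hVrefl _⟩, hVrefl _⟩

theorem mainTheorem10 {G : Type v} [Group G] {X : Type u} [UniformSpace X] [MulAction G X]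
    [UniformContinuousConstSMul G X] (𝒳 : BornCoarse X)
    (hact : ∀ g : G, 𝒳.IsMorphism 𝒳 (fun x => g • x))
    (hbdd : 𝒳.IsBdd univ) (hmax : 𝒳.IsEntourage univ)
    (hfin : ∀ V ∈ 𝓤 X, ∃ F : Set X, F.Finite ∧ ∀ x, ∃ y ∈ F, (x, y) ∈ V)
    (hscale : ∃ U : ℕ → SetRel X X, IsUniformScale U)
    [MeasurableSpace X] [BorelSpace X] (ν : Measure X) [IsProbabilityMeasure ν]
    [ν.IsOpenPosMeasure] [ErgodicSMul G X ν] (hgap : HasSpectralGap G ν) :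
    (∃ ι : Type, Nonempty (PartitionData 𝒳 ν ι)) ∧
    ∀ {ι : Type w} (D : PartitionData 𝒳 ν ι),
      drutuNowak ν ∈ ControlledHilbert.roeAlgebra (SqQuot 𝒳 hact) D.hilbert ∧
      ∃ p : KX0 (SqQuot 𝒳 hact),
        (∀ c, KX0.IsClassOf (E := D.hilbert) (drutuNowak ν) c ↔ c = p) ∧
        (∀ k : ℤ, KX0.map (shift_isMorphism 𝒳 hact k) p = p) ∧
        ∀ n : ℤ, KX0.traceAt (component_isBdd 𝒳 hbdd hact n) (component_isSummand 𝒳 hact n) p = 1 := by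
  refine ⟨exists_partitionData 𝒳 hmax hfin hscale ν, fun D => ⟨?_, ?_⟩⟩
  · exact ControlledHilbert.mem_roeAlgebra_of_isApprox D.μ_mem_blocks
      (D.blocks_isLocallyFinite hact) D.blocks_isDeterminedOnPoints
      (isStarProjection_drutuNowak ν) D.drutuNowak_mem_blocks (D.isApprox_drutuNowak hact hgap)
  · exact D.exists_class_drutuNowak hact hbdd hgap
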